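/- Let $k$ be a commutative unital ring and $G$ a group. Algebras are associative $k$-algebras, not necessarily unital. For submodules (or subsets) $P,Q$, $PQ$ denotes the $k$-span of all products; similarly $PX$ and $XP$ for modules. A \emph{twisted partial action} $T=(\{D_g\},\{\alpha_g\},\{w_{g,h}\})$ of $G$ on an algebra $A$ consists of two-sided ideals $D_g$ of $A$, algebra isomorphisms $\alpha_g:D_{g^{-1}}\to D_g$ and invertible multipliers $w_{g,h}$ of the algebra $D_gD_{gh}$ such that, for all $g,h,t\in G$: $D_g^2=D_g$ and $D_gD_h=D_hD_g$; $D_1=A$ and $\alpha_1=\mathrm{id}_A$; $\alpha_g(D_{g^{-1}}D_h)=D_gD_{gh}$; $\alpha_g(\alpha_h(a))=w_{g,h}\,\alpha_{gh}(a)\,w_{g,h}^{-1}$ for $a\in D_{h^{-1}}D_{h^{-1}g^{-1}}$; $w_{1,g}=w_{g,1}=1$; and $\alpha_g(a\,w_{h,t})\,w_{g,ht}=\alpha_g(a)\,w_{g,h}\,w_{gh,t}$ for $a\in D_{g^{-1}}D_hD_{ht}$. Its \emph{crossed product} $A\rtimes_T G$ is the (associative) $G$-graded algebra $\bigoplus_{g\in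 G}D_g\delta_g$ with product $(a\delta_g)(b\delta_h)=\alpha_g(\alpha_g^{-1}(a)b)\,w_{g,h}\,\delta_{gh}$. A \emph{product partial action} is a pair $\alpha=(\{D_g\},\{\alpha_g\})$ satisfying the same conditions with all $w_{g,h}=1$; its \emph{skew group algebra} $A\rtimes_\alpha G$ is $\bigoplus_{g}D_g\delta_g$ with product $(a\delta_g)(b\delta_h)=\alpha_g(\alpha_g^{-1}(a)b)\delta_{gh}$. For a $G$-graded algebra $A=\bigoplus_tA_t$ put $D_t^A=A_tA_{t^{-1}}$. Two $G$-graded algebras $A,B$ with $A^2=A$, $B^2=B$ and with all $D^A_t,D^B_t$ idempotent are \emph{strongly-graded-equivalent} if there is a Morita context $(A,B,X,Y,\tau_A,\tau_B)$ with unital $G$-graded bimodules ${}_AX_B=\bigoplus_t X_t$, ${}_BY_A=\bigoplus_t Y_t$, with surjective bimodule maps $\tau_A:X\otimes_BY\to A$, $\tau_B:Y\otimes_AX\to B$ satisfying $\tau_A(X_r\otimes Y_s)\subseteq A_{rs}$ and $\tau_B(Y_r\otimes X_s)\subseteq B_{rs}$ for all $r,s\in G$, such that for all $t\in G$: $D_t^AX_t=X_t=X_tD_{t^{-1}}^B$,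 $D_t^BY_t=Y_t=Y_tD_{t^{-1}}^A$, $\tau_A(X_t\otimes Y_{t^{-1}})=D_t^A$ and $\tau_B(Y_t\otimes X_{t^{-1}})=D_t^B$. \textbf{Statement.} For every twisted partial action $T$ of $G$ on a $k$-algebra $A$ there exist a $k$-algebra $A'$ and a product partial action $\alpha$ of $G$ on $A'$ such that the $G$-graded algebras $A\rtimes_TG$ and $A'\rtimes_\alpha G$ are strongly-graded-equivalent. -/

import Mathlib

universe u u' v w

namespace PartialCrossed

/-! ### Two-sided ideals of non-unital algebras and their products -/

section Ideals

variable (k : Type w) (A : Type u) [CommRing k] [NonUnitalRing A] [Module k A]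

/-- A two-sided ideal of a (not necessarily unital) `k`-algebra `A`. -/
structure AlgIdeal extends Submodule k A where
  mul_mem_left' : ∀ (a : A) {x : A}, x ∈ carrier → a * x ∈ carrier
  mul_mem_right' : ∀ (a : A) {x : A}, x ∈ carrier → x * a ∈ carrier

variable {k A}

namespace AlgIdeal

theorem toSubmodule_injective :
    Function.Injective (AlgIdeal.toSubmodule : AlgIdeal k A → Submodule k A) := by
  rintro ⟨_, _, _⟩ ⟨_, _, _⟩ h
  congr

instance : SetLike (AlgIdeal k A) A where
  coe I := I.carrier
  coe_injective := SetLike.coe_injective.comp toSubmodule_injective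

instance : PartialOrder (AlgIdeal k A) := .ofSetLike (AlgIdeal k A) A

theorem mem_toSubmodule {I : AlgIdeal k A} {x : A} : x ∈ I.toSubmodule ↔ x ∈ I := Iff.rfl

theorem mul_mem_left (I : AlgIdeal k A) (a : A) {x : A} (hx : x ∈ I) : a * x ∈ I :=
  I.mul_mem_left' a hx

theorem mul_mem_right (I : AlgIdeal k A) (a : A) {x : A} (hx : x ∈ I) : x * a ∈ I :=
  I.mul_mem_right' a hx

instance : NonUnitalSubringClass (AlgIdeal k A) A where
  add_mem {I _ _} hx hy := I.toSubmodule.add_mem hx hy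
  zero_mem I := I.toSubmodule.zero_mem
  neg_mem {I _} hx := I.toSubmodule.neg_mem hx
  mul_mem {I x _} _ hy := I.mul_mem_left x hy

instance : SMulMemClass (AlgIdeal k A) k A where
  smul_mem {I} r _ hx := I.toSubmodule.smul_mem r hx

end AlgIdeal

variable [IsScalarTower k A A] [SMulCommClass k A A]

/-- The product `P Q` of two `k`-submodules of an algebra: the `k`-span of the products `p * q`. -/
def mulSpan (P Q : Submodule k A) : Submodule k A :=
  Submodule.map₂ (LinearMap.mul k A) P Q

namespace AlgIdeal

/-- The product `I J` of two ideals: the `k`-span of the products `x * y`, `x ∈ I`, `y ∈ J`. -/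
instance : Mul (AlgIdeal k A) where
  mul I J :=
    { mulSpan I.toSubmodule J.toSubmodule with
      mul_mem_left' := by
        intro a x hx
        have : mulSpan I.toSubmodule J.toSubmodule ≤
            (mulSpan I.toSubmodule J.toSubmodule).comap (LinearMap.mul k A a) := by
          refine Submodule.map₂_le.2 fun m hm n hn => ?_
          have := Submodule.apply_mem_map₂ (LinearMap.mul k A)
            (show a * m ∈ I.toSubmodule from I.mul_mem_left a hm) hn
          simpa [mulSpan, mul_assoc] using this
        exact this hx
      mul_mem_right' := by
        intro a x hx
        have : mulSpan I.toSubmodule J.toSubmodule ≤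
            (mulSpan I.toSubmodule J.toSubmodule).comap ((LinearMap.mul k A).flip a) := by
          refine Submodule.map₂_le.2 fun m hm n hn => ?_
          have := Submodule.apply_mem_map₂ (LinearMap.mul k A) hm
            (show n * a ∈ J.toSubmodule from J.mul_mem_right a hn)
          simpa [mulSpan, mul_assoc] using this
        exact this hx }

theorem mul_toSubmodule (I J : AlgIdeal k A) :
    (I * J).toSubmodule = mulSpan I.toSubmodule J.toSubmodule := rfl

theorem mul_mem_mul {I J : AlgIdeal k A} {x y : A} (hx : x ∈ I) (hy : y ∈ J) :
    x * y ∈ I * J :=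
  Submodule.apply_mem_map₂ (LinearMap.mul k A) (p := I.toSubmodule) (q := J.toSubmodule) hx hy

/-- To check that `I J` lies in a submodule it suffices to check products. -/
theorem mul_le_submodule {I J : AlgIdeal k A} {S : Submodule k A}
    (h : ∀ x ∈ I, ∀ y ∈ J, x * y ∈ S) : (I * J).toSubmodule ≤ S :=
  Submodule.map₂_le.2 fun m hm n hn => h m hm n hn

theorem mul_le_left (I J : AlgIdeal k A) : I * J ≤ I :=
  mul_le_submodule (S := I.toSubmodule) fun _ hx y _ => I.mul_mem_right y hx

theorem mul_le_right (I J : AlgIdeal k A) : I * J ≤ J :=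
  mul_le_submodule (S := J.toSubmodule) fun x _ _ hy => J.mul_mem_left x hy

theorem mul_mono {I I' J J' : AlgIdeal k A} (h : I ≤ I') (h' : J ≤ J') : I * J ≤ I' * J' :=
  mul_le_submodule (S := (I' * J').toSubmodule) fun _ hx _ hy => mul_mem_mul (h hx) (h' hy)

instance : Semigroup (AlgIdeal k A) where
  mul_assoc I J K := by
    apply le_antisymm
    · refine mul_le_submodule (S := (I * (J * K)).toSubmodule) fun x hx z hz => ?_
      have : (I * J).toSubmodule ≤
          (I * (J * K)).toSubmodule.comap ((LinearMap.mul k A).flip z) := by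
        refine mul_le_submodule fun a ha b hb => ?_
        change a * b * z ∈ I * (J * K)
        rw [mul_assoc]
        exact mul_mem_mul ha (mul_mem_mul hb hz)
      exact this hx
    · refine mul_le_submodule (S := (I * J * K).toSubmodule) fun x hx z hz => ?_
      have : (J * K).toSubmodule ≤
          (I * J * K).toSubmodule.comap (LinearMap.mul k A x) := by
        refine mul_le_submodule fun a ha b hb => ?_
        change x * (a * b) ∈ I * J * K
        rw [← mul_assoc]
        exact mul_mem_mul (mul_mem_mul hx ha) hb
      exact this hz

/-- The multiplication `I × J → I J` as a bilinear map. -/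
def mulMap (I J : AlgIdeal k A) : I →ₗ[k] J →ₗ[k] ↥(I * J) :=
  LinearMap.mk₂ k (fun x y => ⟨(x : A) * y, mul_mem_mul x.2 y.2⟩)
    (fun _ _ _ => Subtype.ext (add_mul _ _ _)) (fun _ _ _ => Subtype.ext (smul_mul_assoc _ _ _))
    (fun _ _ _ => Subtype.ext (mul_add _ _ _)) (fun _ _ _ => Subtype.ext (mul_smul_comm _ _ _))

/-- The inclusion of an ideal into a larger one. -/
def incl {I J : AlgIdeal k A} (h : I ≤ J) : I →ₗ[k] J where
  toFun x := ⟨x, h x.2⟩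
  map_add' _ _ := rfl
  map_smul' _ _ := rfl

end AlgIdeal

end Ideals

/-! ### Multipliers -/

section Multipliers

variable (k : Type w) (B : Type u) [CommRing k] [NonUnitalRing B] [Module k B]

/-- A multiplier `(L, R)` of the algebra `B`. One writes `w b = L b` and `b w = R b`. -/
@[ext]
structure Multiplier where
  L : B →ₗ[k] B
  R : B →ₗ[k] B
  L_mul : ∀ a b, L (a * b) = L a * b
  R_mul : ∀ a b, R (a * b) = a * R b
  R_mul_eq : ∀ a b, R a * b = a * L b

variable {k B}

/-- The multiplier algebra (here: its multiplicative monoid), `(L, R)(L', R') = (L L', R' R)`. -/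
instance : Monoid (Multiplier k B) where
  mul w w' :=
    { L := w.L ∘ₗ w'.L
      R := w'.R ∘ₗ w.R
      L_mul := fun a b => by simp [w.L_mul, w'.L_mul]
      R_mul := fun a b => by simp [w.R_mul, w'.R_mul]
      R_mul_eq := fun a b => by simp [w.R_mul_eq, w'.R_mul_eq] }
  one :=
    { L := LinearMap.id
      R := LinearMap.id
      L_mul := fun _ _ => rfl
      R_mul := fun _ _ => rfl
      R_mul_eq := fun _ _ => rfl }
  mul_assoc _ _ _ := rfl
  one_mul _ := rfl
  mul_one _ := rfl

theorem Multiplier.mul_R_apply (w w' : Multiplier k B) (x : B) : (w * w').R x = w'.R (w.R x) := rfl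

theorem Multiplier.one_R_apply (x : B) : (1 : Multiplier k B).R x = x := rfl

theorem Multiplier.one_L_apply (x : B) : (1 : Multiplier k B).L x = x := rfl

theorem Multiplier.R_R_inv (w : (Multiplier k B)ˣ) (x : B) :
    (w : Multiplier k B).R ((↑(w⁻¹) : Multiplier k B).R x) = x := by
  rw [← Multiplier.mul_R_apply, Units.inv_mul, Multiplier.one_R_apply]

end Multipliers

section MultiplierIdeal

variable {k : Type w} {A : Type u} [CommRing k] [NonUnitalRing A] [Module k A]
  [IsScalarTower k A A] [SMulCommClass k A A]

/-- A right multiplier of an idempotent ideal `J` of `A` is left `A`-linear. -/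
theorem AlgIdeal.R_left_linear {J : AlgIdeal k A} (hJ : J * J = J) (R : J →ₗ[k] J)
    (hR : ∀ x y, R (x * y) = x * R y) (a : A) (x : J) :
    (R ⟨a * x, J.mul_mem_left a x.2⟩ : A) = a * (R x : A) := by
  let l : J →ₗ[k] J :=
    { toFun := fun y => ⟨a * y, J.mul_mem_left a y.2⟩
      map_add' := fun _ _ => Subtype.ext (mul_add _ _ _)
      map_smul' := fun _ _ => Subtype.ext (mul_smul_comm _ _ _) }
  have key : (J * J).toSubmodule ≤ (LinearMap.ker (R ∘ₗ l - l ∘ₗ R)).map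
      J.toSubmodule.subtype := by
    refine AlgIdeal.mul_le_submodule fun y hy z hz => ?_
    refine ⟨(⟨y, hy⟩ * ⟨z, hz⟩ : J), ?_, rfl⟩
    rw [SetLike.mem_coe, LinearMap.mem_ker, LinearMap.sub_apply, sub_eq_zero]
    have h1 : l (⟨y, hy⟩ * ⟨z, hz⟩ : J) = l ⟨y, hy⟩ * ⟨z, hz⟩ :=
      Subtype.ext (mul_assoc a y z).symm
    rw [LinearMap.comp_apply, LinearMap.comp_apply, h1, hR, hR]
    exact Subtype.ext (mul_assoc _ _ _)
  have hx : (x : A) ∈ (J * J).toSubmodule := by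
    rw [AlgIdeal.mem_toSubmodule, hJ]
    exact x.2
  obtain ⟨y, hy, hyx⟩ := key hx
  obtain rfl : y = x := Subtype.ext hyx
  rw [SetLike.mem_coe, LinearMap.mem_ker, LinearMap.sub_apply, sub_eq_zero] at hy
  exact congrArg Subtype.val hy

/-- If `J` is idempotent, right multipliers of `J` preserve `I J`. -/
theorem AlgIdeal.R_mem_mul {I J : AlgIdeal k A} (hJ : J * J = J) (R : J →ₗ[k] J)
    (hR : ∀ x y, R (x * y) = x * R y) (x : J) (hx : (x : A) ∈ I * J) : (R x : A) ∈ I * J := by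
  have key : (I * J).toSubmodule ≤
      ((I * J).toSubmodule.comap (J.toSubmodule.subtype ∘ₗ R)).map J.toSubmodule.subtype := by
    refine AlgIdeal.mul_le_submodule fun y hy z hz => ?_
    refine ⟨⟨y * z, J.mul_mem_left y hz⟩, ?_, rfl⟩
    change (R ⟨y * z, _⟩ : A) ∈ I * J
    rw [AlgIdeal.R_left_linear hJ R hR y ⟨z, hz⟩]
    exact AlgIdeal.mul_mem_mul hy (R ⟨z, hz⟩).2
  obtain ⟨y, hy, hyx⟩ := key hx
  obtain rfl : y = x := Subtype.ext hyx
  exact hy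

/-- Left and right multipliers of an idempotent ideal commute. -/
theorem AlgIdeal.L_R_comm {J : AlgIdeal k A} (hJ : J * J = J) (L R : J →ₗ[k] J)
    (hL : ∀ x y, L (x * y) = L x * y) (hR : ∀ x y, R (x * y) = x * R y) (x : J) :
    L (R x) = R (L x) := by
  have key : (J * J).toSubmodule ≤ (LinearMap.ker (L ∘ₗ R - R ∘ₗ L)).map
      J.toSubmodule.subtype := by
    refine AlgIdeal.mul_le_submodule fun y hy z hz => ?_
    refine ⟨(⟨y, hy⟩ * ⟨z, hz⟩ : J), ?_, rfl⟩
    rw [SetLike.mem_coe, LinearMap.mem_ker, LinearMap.sub_apply, sub_eq_zero,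
      LinearMap.comp_apply, LinearMap.comp_apply, hR, hL, hL, hR]
  have hx : (x : A) ∈ (J * J).toSubmodule := by
    rw [AlgIdeal.mem_toSubmodule, hJ]
    exact x.2
  obtain ⟨y, hy, hyx⟩ := key hx
  obtain rfl : y = x := Subtype.ext hyx
  rwa [SetLike.mem_coe, LinearMap.mem_ker, LinearMap.sub_apply, sub_eq_zero] at hy

end MultiplierIdeal

/-! ### Product partial actions and twisted partial actions -/

section Actions

variable (k : Type w) (G : Type v) (A : Type u) [CommRing k] [Group G] [NonUnitalRing A]
  [Module k A] [IsScalarTower k A A] [SMulCommClass k A A]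

/-- The data and axioms shared by product partial actions and twisted partial actions of `G` on
`A`: idempotent, pairwise commuting two-sided ideals `D g` and algebra isomorphisms
`α g : D g⁻¹ ≃ D g` such that `D 1 = A`, `α 1 = id` and
`α g (D g⁻¹ D h) = D g D (g h)`. -/
structure PartialDatum where
  D : G → AlgIdeal k A
  α : ∀ g, ↥(D g⁻¹) ≃ₗ[k] ↥(D g)
  α_mul : ∀ g (x y : ↥(D g⁻¹)), α g (x * y) = α g x * α g y
  D_one : ∀ a : A, a ∈ D 1
  α_one : ∀ x : ↥(D 1⁻¹), (α 1 x : A) = x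
  D_idem : ∀ g, D g * D g = D g
  D_comm : ∀ g h, D g * D h = D h * D g
  α_image : ∀ g h, (fun x : ↥(D g⁻¹) => (α g x : A)) '' {x | (x : A) ∈ D g⁻¹ * D h}
    = (D g * D (g * h) : AlgIdeal k A)

variable {k G A}

namespace PartialDatum

variable (P : PartialDatum k G A)

theorem mul_idem (g h : G) : (P.D g * P.D h) * (P.D g * P.D h) = P.D g * P.D h := by
  rw [mul_assoc, ← mul_assoc (P.D h), P.D_comm h g, mul_assoc, P.D_idem, ← mul_assoc, P.D_idem]

theorem α_mem {g h : G} {x : A} (hx : x ∈ P.D g⁻¹) (hxh : x ∈ P.D g⁻¹ * P.D h) :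
    (P.α g ⟨x, hx⟩ : A) ∈ P.D g * P.D (g * h) := by
  have := P.α_image g h
  exact (Set.ext_iff.1 this _).1 ⟨⟨x, hx⟩, hxh, rfl⟩

theorem mem_left {I J : AlgIdeal k A} {x : A} (hx : x ∈ I * J) : x ∈ I :=
  AlgIdeal.mul_le_left _ _ hx

theorem mem_right {I J : AlgIdeal k A} {x : A} (hx : x ∈ I * J) : x ∈ J :=
  AlgIdeal.mul_le_right _ _ hx

/-- `α g (D g⁻¹ D h D f) ⊆ D g D (g h) D (g f)`. -/
theorem α_mem₃ {g h f : G} {x : A} (hx : x ∈ P.D g⁻¹)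
    (hxh : x ∈ P.D g⁻¹ * P.D h * P.D f) :
    (P.α g ⟨x, hx⟩ : A) ∈ P.D g * P.D (g * h) * P.D (g * f) := by
  have e : P.D g⁻¹ * P.D h * P.D f = (P.D g⁻¹ * P.D h) * (P.D g⁻¹ * P.D f) := by
    calc P.D g⁻¹ * P.D h * P.D f = (P.D g⁻¹ * P.D g⁻¹) * P.D h * P.D f := by rw [P.D_idem]
      _ = P.D g⁻¹ * (P.D g⁻¹ * P.D h) * P.D f := by rw [mul_assoc (P.D g⁻¹) (P.D g⁻¹)]
      _ = P.D g⁻¹ * (P.D h * P.D g⁻¹) * P.D f := by rw [P.D_comm h]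
      _ = _ := by simp only [mul_assoc]
  have key : ((P.D g⁻¹ * P.D h) * (P.D g⁻¹ * P.D f)).toSubmodule ≤
      ((P.D g * P.D (g * h) * P.D (g * f)).toSubmodule.comap
        ((P.D g).toSubmodule.subtype ∘ₗ (P.α g).toLinearMap)).map
        (P.D g⁻¹).toSubmodule.subtype := by
    refine AlgIdeal.mul_le_submodule fun y hy z hz => ?_
    refine ⟨(⟨y, mem_left hy⟩ * ⟨z, mem_left hz⟩ : ↥(P.D g⁻¹)), ?_, rfl⟩
    change ((P.α g ((⟨y, mem_left hy⟩ : ↥(P.D g⁻¹)) * (⟨z, mem_left hz⟩ : ↥(P.D g⁻¹))) :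
      ↥(P.D g)) : A) ∈ P.D g * P.D (g * h) * P.D (g * f)
    rw [P.α_mul]
    exact AlgIdeal.mul_mem_mul (P.α_mem (mem_left hy) hy) (mem_right (P.α_mem (mem_left hz) hz))
  rw [e] at hxh
  obtain ⟨y, hy, hyx⟩ := key hxh
  obtain rfl : y = ⟨x, hx⟩ := Subtype.ext hyx
  exact hy

/-- `α g` restricted to `D g⁻¹ D h → D g D (g h)`. -/
def αRes (g h : G) : ↥(P.D g⁻¹ * P.D h) →ₗ[k] ↥(P.D g * P.D (g * h)) where
  toFun x := ⟨P.α g ⟨x, mem_left x.2⟩, P.α_mem _ x.2⟩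
  map_add' x y := Subtype.ext (congrArg (Subtype.val : P.D g → A)
    ((P.α g).map_add ⟨(x : A), mem_left x.2⟩ ⟨(y : A), mem_left y.2⟩))
  map_smul' r x := Subtype.ext (congrArg (Subtype.val : P.D g → A)
    ((P.α g).map_smul r ⟨(x : A), mem_left x.2⟩))

section Domains

/-! Membership facts showing that the two sides of the composition law and of the cocycle
identity below are defined. -/

variable {g h t : G} {x : A}

theorem comp_mem₁ (hx : x ∈ P.D h⁻¹ * P.D (h⁻¹ * g⁻¹)) :
    (P.α h ⟨x, mem_left hx⟩ : A) ∈ P.D g⁻¹ * P.D h := by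
  have := P.α_mem (mem_left hx) hx
  rwa [mul_inv_cancel_left, P.D_comm] at this

theorem comp_mem₂ (hx : x ∈ P.D h⁻¹ * P.D (h⁻¹ * g⁻¹)) : x ∈ P.D (g * h)⁻¹ * P.D h⁻¹ := by
  rwa [mul_inv_rev, P.D_comm]

theorem comp_mem₃ (hx : x ∈ P.D h⁻¹ * P.D (h⁻¹ * g⁻¹)) :
    (P.α (g * h) ⟨x, mem_left (P.comp_mem₂ hx)⟩ : A) ∈ P.D g * P.D (g * h) := by
  have := P.α_mem (mem_left (P.comp_mem₂ hx)) (P.comp_mem₂ hx)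
  rwa [mul_inv_cancel_right, P.D_comm] at this

theorem coc_mem₁ (hx : x ∈ P.D g⁻¹ * P.D h * P.D (h * t)) : x ∈ P.D h * P.D (h * t) := by
  rw [mul_assoc] at hx
  exact mem_right hx

theorem coc_mem₂ (w : Multiplier k ↥(P.D h * P.D (h * t)))
    (hx : x ∈ P.D g⁻¹ * P.D h * P.D (h * t)) :
    (w.R ⟨x, P.coc_mem₁ hx⟩ : A) ∈ P.D g⁻¹ * P.D h * P.D (h * t) := by
  rw [mul_assoc] at hx ⊢
  exact AlgIdeal.R_mem_mul (P.mul_idem _ _) w.R w.R_mul ⟨x, mem_right hx⟩ hx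

theorem coc_mem₃ (w : Multiplier k ↥(P.D h * P.D (h * t)))
    (hx : x ∈ P.D g⁻¹ * P.D h * P.D (h * t)) :
    (w.R ⟨x, P.coc_mem₁ hx⟩ : A) ∈ P.D g⁻¹ * P.D (h * t) :=
  AlgIdeal.mul_mono (AlgIdeal.mul_le_left _ _) le_rfl (P.coc_mem₂ w hx)

theorem coc_mem₄ (hx : x ∈ P.D g⁻¹ * P.D h * P.D (h * t)) : x ∈ P.D g⁻¹ * P.D h :=
  mem_left hx

theorem coc_mem₅ (w : Multiplier k ↥(P.D g * P.D (g * h)))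
    (hx : x ∈ P.D g⁻¹ * P.D h * P.D (h * t)) :
    (w.R ⟨P.α g ⟨x, mem_left (P.coc_mem₄ hx)⟩, P.α_mem _ (P.coc_mem₄ hx)⟩ : A) ∈
      P.D (g * h) * P.D (g * h * t) := by
  have h1 := P.α_mem₃ (mem_left (P.coc_mem₄ hx)) hx
  have e : P.D g * P.D (g * h) * P.D (g * (h * t)) =
      P.D (g * h * t) * (P.D g * P.D (g * h)) := by
    rw [← mul_assoc g h t, mul_assoc, P.D_comm (g * h) (g * h * t), ← mul_assoc,
      P.D_comm g, mul_assoc]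
  rw [e] at h1
  have h2 := AlgIdeal.R_mem_mul (P.mul_idem g (g * h)) w.R w.R_mul
    ⟨_, P.α_mem _ (P.coc_mem₄ hx)⟩ h1
  have h3 := AlgIdeal.mul_mono (le_refl (P.D (g * h * t))) (AlgIdeal.mul_le_right _ _) h2
  rwa [P.D_comm] at h3

end Domains

end PartialDatum

variable (k G A)

/-- A product partial action of the group `G` on the algebra `A`. -/
structure ProductPartialAction extends PartialDatum k G A where
  comp : ∀ g h (x : A) (hx : x ∈ D h⁻¹ * D (h⁻¹ * g⁻¹)),
    (α g ⟨α h ⟨x, PartialDatum.mem_left hx⟩,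
        PartialDatum.mem_left (toPartialDatum.comp_mem₁ hx)⟩ : A) =
      α (g * h) ⟨x, PartialDatum.mem_left (toPartialDatum.comp_mem₂ hx)⟩

/-- A twisted partial action of the group `G` on the algebra `A`: the data of a `PartialDatum`
together with invertible multipliers `w g h` of `D g D (g h)` such that
* `α g (α h x) = w g h · α (g h) x · (w g h)⁻¹` for `x ∈ D h⁻¹ D (h⁻¹ g⁻¹)`;
* `w 1 g = w g 1 = 1`;
* `α g (x · w h t) · w g (h t) = α g x · w g h · w (g h) t` for
  `x ∈ D g⁻¹ D h D (h t)`. -/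
structure TwistedPartialAction extends PartialDatum k G A where
  w : ∀ g h, (Multiplier k ↥(D g * D (g * h)))ˣ
  comp : ∀ g h (x : A) (hx : x ∈ D h⁻¹ * D (h⁻¹ * g⁻¹)),
    (α g ⟨α h ⟨x, PartialDatum.mem_left hx⟩,
        PartialDatum.mem_left (toPartialDatum.comp_mem₁ hx)⟩ : A) =
      (↑(w g h)⁻¹ : Multiplier k ↥(D g * D (g * h))).R ((w g h).val.L
        ⟨α (g * h) ⟨x, PartialDatum.mem_left (toPartialDatum.comp_mem₂ hx)⟩,
          toPartialDatum.comp_mem₃ hx⟩)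
  w_one_left : ∀ g, w 1 g = 1
  w_one_right : ∀ g, w g 1 = 1
  cocycle : ∀ g h t (x : A) (hx : x ∈ D g⁻¹ * D h * D (h * t)),
    ((w g (h * t)).val.R
      ⟨α g ⟨(w h t).val.R ⟨x, toPartialDatum.coc_mem₁ hx⟩,
          PartialDatum.mem_left (toPartialDatum.coc_mem₃ _ hx)⟩,
        toPartialDatum.α_mem _ (toPartialDatum.coc_mem₃ _ hx)⟩ : A) =
    (w (g * h) t).val.R
      ⟨(w g h).val.R ⟨α g ⟨x, PartialDatum.mem_left (toPartialDatum.coc_mem₄ hx)⟩,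
          toPartialDatum.α_mem _ (toPartialDatum.coc_mem₄ hx)⟩,
        toPartialDatum.coc_mem₅ _ hx⟩

end Actions

/-! ### Crossed products -/

section CrossedProducts

variable {k : Type w} {G : Type v} {A : Type u} [CommRing k] [Group G] [NonUnitalRing A]
  [Module k A] [IsScalarTower k A A] [SMulCommClass k A A]

namespace TwistedPartialAction

variable (T : TwistedPartialAction k G A)

/-- The map `D g × D h → D (g h)`, `(a, b) ↦ α g ((α g)⁻¹ a * b) · w g h`. -/
def mulComp (g h : G) : T.D g →ₗ[k] T.D h →ₗ[k] T.D (g * h) :=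
  ((AlgIdeal.mulMap (T.D g⁻¹) (T.D h)) ∘ₗ (T.α g).symm.toLinearMap).compr₂
    (AlgIdeal.incl (AlgIdeal.mul_le_right (T.D g) (T.D (g * h))) ∘ₗ
      (T.w g h).val.R ∘ₗ T.αRes g h)

theorem mulComp_apply (g h : G) (a : T.D g) (b : T.D h) :
    (T.mulComp g h a b : A) = (T.w g h).val.R
      ⟨T.α g ⟨((T.α g).symm a : A) * b,
        (T.D g⁻¹).mul_mem_right _ ((T.α g).symm a).2⟩,
        T.α_mem _ (AlgIdeal.mul_mem_mul ((T.α g).symm a).2 b.2)⟩ := rfl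

open scoped Classical in
/-- The multiplication of the crossed product, as a bilinear map on `⊕ D g`. -/
noncomputable def mulHom : (DirectSum G fun g => T.D g) →ₗ[k]
    (DirectSum G fun g => T.D g) →ₗ[k] DirectSum G fun g => T.D g :=
  DirectSum.toModule k G _ fun g => LinearMap.flip <|
    DirectSum.toModule k G _ fun h =>
      ((T.mulComp g h).compr₂ (DirectSum.lof k G (fun g => T.D g) (g * h))).flip

open scoped Classical in
theorem mulHom_lof (g h : G) (a : T.D g) (b : T.D h) :
    T.mulHom (DirectSum.lof k G (fun g => T.D g) g a) (DirectSum.lof k G (fun g => T.D g) h b) =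
      DirectSum.lof k G (fun g => T.D g) (g * h) (T.mulComp g h a b) := by
  unfold mulHom
  rw [DirectSum.toModule_lof, LinearMap.flip_apply, DirectSum.toModule_lof]
  rfl

open scoped Classical in
theorem lof_congr {g g' : G} (h : g = g') {a : T.D g} {a' : T.D g'} (ha : (a : A) = a') :
    DirectSum.lof k G (fun g => T.D g) g a = DirectSum.lof k G (fun g => T.D g) g' a' := by
  subst h
  rw [Subtype.ext ha]

/-- The composition law in the form `α g (α h x) · w g h = w g h · α (g h) x`. -/
theorem comp_w {g h : G} {x : A} (hx : x ∈ T.D h⁻¹ * T.D (h⁻¹ * g⁻¹))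
    (y : ↥(T.D g * T.D (g * h)))
    (hy : (y : A) = T.α g ⟨T.α h ⟨x, PartialDatum.mem_left hx⟩,
      PartialDatum.mem_left (T.comp_mem₁ hx)⟩) :
    (T.w g h).val.R y = (T.w g h).val.L
      ⟨T.α (g * h) ⟨x, PartialDatum.mem_left (T.comp_mem₂ hx)⟩, T.comp_mem₃ hx⟩ := by
  rw [T.comp g h x hx] at hy
  rw [Subtype.ext hy, Multiplier.R_R_inv]

/-- The right multiplier `z ↦ α h ((α h)⁻¹ z * c)` of `D h`. -/
def rho (h : G) (c : A) : T.D h →ₗ[k] T.D h where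
  toFun z := T.α h ⟨((T.α h).symm z : A) * c, (T.D h⁻¹).mul_mem_right c ((T.α h).symm z).2⟩
  map_add' x y := by
    rw [← map_add]
    congr 1
    exact Subtype.ext (by simp [add_mul])
  map_smul' r x := by
    rw [RingHom.id_apply, ← map_smul]
    congr 1
    exact Subtype.ext (by simp [smul_mul_assoc])

theorem rho_mul (h : G) (c : A) (x y : T.D h) : T.rho h c (x * y) = x * T.rho h c y := by
  have e : (T.α h).symm (x * y) = (T.α h).symm x * (T.α h).symm y := by
    rw [LinearEquiv.symm_apply_eq, T.α_mul, LinearEquiv.apply_symm_apply,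
      LinearEquiv.apply_symm_apply]
  have e2 : (⟨((T.α h).symm (x * y) : A) * c,
      (T.D h⁻¹).mul_mem_right c ((T.α h).symm (x * y)).2⟩ : ↥(T.D h⁻¹)) =
      (T.α h).symm x * ⟨((T.α h).symm y : A) * c,
        (T.D h⁻¹).mul_mem_right c ((T.α h).symm y).2⟩ :=
    Subtype.ext (by rw [e]; exact mul_assoc _ _ _)
  change T.α h _ = x * T.α h _
  rw [e2, T.α_mul, LinearEquiv.apply_symm_apply]

theorem rho_mem {h : G} (c : A) {I : AlgIdeal k A} {z : A} (hz : z ∈ I * T.D h) :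
    (T.rho h c ⟨z, PartialDatum.mem_right hz⟩ : A) ∈ I * T.D h :=
  AlgIdeal.R_mem_mul (T.D_idem h) (T.rho h c) (T.rho_mul h c) ⟨z, PartialDatum.mem_right hz⟩ hz

/-- `rho h c` restricted to an ideal of the form `I D h`. -/
def rhoRes (h : G) (c : A) (I : AlgIdeal k A) : ↥(I * T.D h) →ₗ[k] ↥(I * T.D h) where
  toFun z := ⟨T.rho h c ⟨z, PartialDatum.mem_right z.2⟩, T.rho_mem c z.2⟩
  map_add' x y := Subtype.ext (congrArg (Subtype.val : T.D h → A)
    ((T.rho h c).map_add ⟨(x : A), PartialDatum.mem_right x.2⟩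
      ⟨(y : A), PartialDatum.mem_right y.2⟩))
  map_smul' r x := Subtype.ext (congrArg (Subtype.val : T.D h → A)
    ((T.rho h c).map_smul r ⟨(x : A), PartialDatum.mem_right x.2⟩))

theorem rho_α {h : G} (c : A) {x : A} (hx : x ∈ T.D h⁻¹) :
    T.rho h c (T.α h ⟨x, hx⟩) = T.α h ⟨x * c, (T.D h⁻¹).mul_mem_right c hx⟩ := by
  change T.α h _ = T.α h _
  congr 1
  apply Subtype.ext
  change ((T.α h).symm (T.α h ⟨x, hx⟩) : A) * c = x * c
  rw [LinearEquiv.symm_apply_apply]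

/-- The right multiplier `rho (g h) c` is intertwined with `rho h c` by `v ↦ α g v · w g h`. -/
theorem rho_w {g h : G} (c : A) {v : A} (hv : v ∈ T.D g⁻¹ * T.D h) :
    (T.rho (g * h) c ⟨(T.w g h).val.R (T.αRes g h ⟨v, hv⟩),
      PartialDatum.mem_right ((T.w g h).val.R (T.αRes g h ⟨v, hv⟩)).2⟩ : A) =
    (T.w g h).val.R (T.αRes g h ⟨T.rho h c ⟨v, PartialDatum.mem_right hv⟩, T.rho_mem c hv⟩) := by
  have hv' : v ∈ T.D h * T.D (h * (h⁻¹ * g⁻¹)) := by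
    rwa [mul_inv_cancel_left, T.D_comm]
  obtain ⟨⟨u, hu'⟩, hu, huv⟩ := (Set.ext_iff.1 (T.α_image h (h⁻¹ * g⁻¹)) v).2 hv'
  replace hu : u ∈ T.D h⁻¹ * T.D (h⁻¹ * g⁻¹) := hu
  replace huv : (T.α h ⟨u, hu'⟩ : A) = v := huv
  subst huv
  have huc : u * c ∈ T.D h⁻¹ * T.D (h⁻¹ * g⁻¹) := AlgIdeal.mul_mem_right _ c hu
  have e1 := T.comp_w hu (T.αRes g h ⟨_, hv⟩) rfl
  have e2 := T.comp_w huc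
    (T.αRes g h ⟨T.rho h c ⟨_, PartialDatum.mem_right hv⟩, T.rho_mem c hv⟩) (by
      change (T.α g _ : A) = T.α g _
      congr 2
      apply Subtype.ext
      exact congrArg (Subtype.val : T.D h → A) (T.rho_α c hu'))
  rw [e1, e2]
  have e3 := AlgIdeal.L_R_comm (T.mul_idem g (g * h)) (T.w g h).val.L
    (T.rhoRes (g * h) c (T.D g)) (T.w g h).val.L_mul
    (fun x y => Subtype.ext (congrArg (Subtype.val : T.D (g * h) → A) (T.rho_mul (g * h) c
      ⟨x, PartialDatum.mem_right x.2⟩ ⟨y, PartialDatum.mem_right y.2⟩)))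
    ⟨T.α (g * h) ⟨u, PartialDatum.mem_left (T.comp_mem₂ hu)⟩, T.comp_mem₃ hu⟩
  refine (congrArg Subtype.val e3).symm.trans ?_
  congr 2
  apply Subtype.ext
  exact congrArg (Subtype.val : T.D (g * h) → A)
    (T.rho_α (h := g * h) c (PartialDatum.mem_left (T.comp_mem₂ hu)))

theorem mulComp_assoc (g h t : G) (a : T.D g) (b : T.D h) (c : T.D t) :
    (T.mulComp (g * h) t (T.mulComp g h a b) c : A) =
      T.mulComp g (h * t) a (T.mulComp h t b c) := by
  set a' := (T.α g).symm a with ha'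
  have hv : (a' : A) * b ∈ T.D g⁻¹ * T.D h := AlgIdeal.mul_mem_mul a'.2 b.2
  -- the product `a' * (b ρ)`, which lies in `D g⁻¹ D h D (h t)`
  have hbc : (T.rho h c b : A) ∈ T.D h * T.D (h * t) :=
    T.α_mem _ (AlgIdeal.mul_mem_mul ((T.α h).symm b).2 c.2)
  have hx : (a' : A) * T.rho h c b ∈ T.D g⁻¹ * T.D h * T.D (h * t) := by
    rw [mul_assoc]
    exact AlgIdeal.mul_mem_mul a'.2 hbc
  have hxv : (T.rho h c ⟨(a' : A) * b, PartialDatum.mem_right hv⟩ : A) = a' * T.rho h c b :=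
    AlgIdeal.R_left_linear (T.D_idem h) (T.rho h c) (T.rho_mul h c) a' b
  have hcoc := T.cocycle g h t _ hx
  have lhs : (T.mulComp (g * h) t (T.mulComp g h a b) c : A) =
      (T.w (g * h) t).val.R
        ⟨(T.w g h).val.R ⟨T.α g ⟨_, PartialDatum.mem_left (T.coc_mem₄ hx)⟩,
          T.α_mem _ (T.coc_mem₄ hx)⟩, T.coc_mem₅ _ hx⟩ := by
    rw [mulComp_apply]
    congr 2
    apply Subtype.ext
    refine (T.rho_w c hv).trans ?_
    congr 2
    apply Subtype.ext
    change (T.α g _ : A) = T.α g _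
    congr 2
    exact Subtype.ext hxv
  have rhs : (T.mulComp g (h * t) a (T.mulComp h t b c) : A) =
      (T.w g (h * t)).val.R
      ⟨T.α g ⟨(T.w h t).val.R ⟨_, T.coc_mem₁ hx⟩,
          PartialDatum.mem_left (T.coc_mem₃ _ hx)⟩,
        T.α_mem _ (T.coc_mem₃ _ hx)⟩ := by
    rw [mulComp_apply]
    congr 2
    apply Subtype.ext
    change (T.α g _ : A) = T.α g _
    congr 2
    apply Subtype.ext
    exact (AlgIdeal.R_left_linear (T.mul_idem h (h * t)) (T.w h t).val.R (T.w h t).val.R_mul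
      a' ⟨_, hbc⟩).symm
  rw [lhs, rhs, hcoc]

theorem mulHom_assoc (x y z : DirectSum G fun g => T.D g) :
    T.mulHom (T.mulHom x y) z = T.mulHom x (T.mulHom y z) := by
  classical
  induction x using DirectSum.induction_on with
  | zero => simp
  | add x x' hx hx' => simp only [map_add, LinearMap.add_apply, hx, hx']
  | of g a =>
    induction y using DirectSum.induction_on with
    | zero => simp
    | add y y' hy hy' => simp only [map_add, LinearMap.add_apply, hy, hy']
    | of h b =>
      induction z using DirectSum.induction_on with
      | zero => simp
      | add z z' hz hz' => simp only [map_add, hz, hz']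
      | of t c =>
        simp only [← DirectSum.lof_eq_of k, mulHom_lof]
        exact T.lof_congr (mul_assoc g h t) (T.mulComp_assoc g h t a b c)

/-- The crossed product of `A` by `T`: the direct sum of the `D g δ_g`, `g ∈ G`, with the product
`(a δ_g) (b δ_h) = α g ((α g)⁻¹ a * b) · w g h δ_(g h)`. -/
def CrossedProduct : Type (max v u) := DirectSum G fun g => T.D g

noncomputable instance : AddCommGroup T.CrossedProduct :=
  inferInstanceAs (AddCommGroup (DirectSum G fun g => T.D g))

noncomputable instance : Module k T.CrossedProduct :=
  inferInstanceAs (Module k (DirectSum G fun g => T.D g))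

noncomputable instance : NonUnitalRing T.CrossedProduct :=
  { (inferInstance : AddCommGroup T.CrossedProduct) with
    mul := fun x y => T.mulHom x y
    left_distrib := fun x y z => (T.mulHom x).map_add y z
    right_distrib := fun x y z => T.mulHom.map_add₂ x y z
    zero_mul := fun x => T.mulHom.map_zero₂ x
    mul_zero := fun x => (T.mulHom x).map_zero
    mul_assoc := T.mulHom_assoc }

instance : IsScalarTower k T.CrossedProduct T.CrossedProduct :=
  ⟨fun r x y => T.mulHom.map_smul₂ r x y⟩

instance : SMulCommClass k T.CrossedProduct T.CrossedProduct :=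
  ⟨fun r x y => ((T.mulHom x).map_smul r y).symm⟩

open scoped Classical in
/-- The inclusion `a ↦ a δ_g` of `D g` into the crossed product. -/
noncomputable def delta (g : G) : T.D g →ₗ[k] T.CrossedProduct :=
  DirectSum.lof k G (fun g => T.D g) g

theorem delta_mul_delta (g h : G) (a : T.D g) (b : T.D h) :
    T.delta g a * T.delta h b = T.delta (g * h) (T.mulComp g h a b) :=
  T.mulHom_lof g h a b

/-- The homogeneous component `D g δ_g` of degree `g` of the crossed product. -/
noncomputable def grading (g : G) : Submodule k T.CrossedProduct :=
  LinearMap.range (T.delta g)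

end TwistedPartialAction

namespace ProductPartialAction

variable (P : ProductPartialAction k G A)

/-- A product partial action, regarded as a twisted partial action with trivial twist. -/
def toTwisted : TwistedPartialAction k G A where
  toPartialDatum := P.toPartialDatum
  w _ _ := 1
  comp := P.comp
  w_one_left _ := rfl
  w_one_right _ := rfl
  cocycle _ _ _ _ _ := rfl

/-- The skew group algebra of a product partial action: the direct sum of the `D g δ_g` with the
product `(a δ_g) (b δ_h) = α g ((α g)⁻¹ a * b) δ_(g h)`. -/
abbrev SkewGroupAlgebra : Type (max v u) := P.toTwisted.CrossedProduct

/-- The inclusion `a ↦ a δ_g` of `D g` into the skew group algebra. -/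
noncomputable abbrev delta (g : G) : P.D g →ₗ[k] P.SkewGroupAlgebra := P.toTwisted.delta g

/-- The product of the skew group algebra, spelled out. -/
theorem delta_mul_delta (g h : G) (a : P.D g) (b : P.D h) :
    P.delta g a * P.delta h b = P.delta (g * h)
      ⟨P.α g ⟨((P.α g).symm a : A) * b, (P.D g⁻¹).mul_mem_right _ ((P.α g).symm a).2⟩,
        PartialDatum.mem_right
          (P.α_mem _ (AlgIdeal.mul_mem_mul ((P.α g).symm a).2 b.2))⟩ :=
  P.toTwisted.delta_mul_delta g h a b

/-- The homogeneous component `D g δ_g` of degree `g` of the skew group algebra. -/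
noncomputable abbrev grading (g : G) : Submodule k P.SkewGroupAlgebra := P.toTwisted.grading g

end ProductPartialAction

end CrossedProducts

/-! ### Graded algebras and strong-graded-equivalence -/

section Graded

variable {k : Type w} {G : Type v} [CommRing k] [Group G]

/-- `M` is the internal direct sum of the submodules `ℳ t`. -/
def IsDirectSum {M : Type*} [AddCommGroup M] [Module k M] (ℳ : G → Submodule k M) : Prop :=
  iSupIndep ℳ ∧ ⨆ t, ℳ t = ⊤

variable {A : Type u} [NonUnitalRing A] [Module k A] [IsScalarTower k A A] [SMulCommClass k A A]

/-- `A = ⊕ 𝒜 t` is a `G`-graded algebra. -/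
structure IsGradedAlgebra (𝒜 : G → Submodule k A) : Prop where
  isDirectSum : IsDirectSum 𝒜
  mul_mem : ∀ s t, ∀ a ∈ 𝒜 s, ∀ b ∈ 𝒜 t, a * b ∈ 𝒜 (s * t)

/-- `D_t = A_t A_{t⁻¹}`. -/
def domainIdeal (𝒜 : G → Submodule k A) (t : G) : Submodule k A := mulSpan (𝒜 t) (𝒜 t⁻¹)

end Graded

section Morita

/-- A Morita context `(A, B, X, Y, τA, τB)` between `k`-algebras: an `(A, B)`-bimodule `X`, a
`(B, A)`-bimodule `Y` and bimodule maps `τA : X ⊗_B Y → A`, `τB : Y ⊗_A X → B` with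
`τA (x ⊗ y) x' = x τB (y ⊗ x')` and `τB (y ⊗ x) y' = y τA (x ⊗ y')`.
The maps `τA`, `τB` are given as balanced bilinear maps. -/
structure MoritaContext (k : Type*) (A B X Y : Type*) [CommRing k]
    [NonUnitalRing A] [Module k A] [IsScalarTower k A A] [SMulCommClass k A A]
    [NonUnitalRing B] [Module k B] [IsScalarTower k B B] [SMulCommClass k B B]
    [AddCommGroup X] [Module k X] [AddCommGroup Y] [Module k Y] where
  /-- left action of `A` on `X` -/
  AX : A →ₗ[k] X →ₗ[k] X
  /-- right action of `B` on `X` -/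
  XB : X →ₗ[k] B →ₗ[k] X
  /-- left action of `B` on `Y` -/
  BY : B →ₗ[k] Y →ₗ[k] Y
  /-- right action of `A` on `Y` -/
  YA : Y →ₗ[k] A →ₗ[k] Y
  AX_mul : ∀ a a' x, AX (a * a') x = AX a (AX a' x)
  XB_mul : ∀ x b b', XB x (b * b') = XB (XB x b) b'
  AX_XB : ∀ a x b, XB (AX a x) b = AX a (XB x b)
  BY_mul : ∀ b b' y, BY (b * b') y = BY b (BY b' y)
  YA_mul : ∀ y a a', YA y (a * a') = YA (YA y a) a'
  BY_YA : ∀ b y a, YA (BY b y) a = BY b (YA y a)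
  τA : X →ₗ[k] Y →ₗ[k] A
  τB : Y →ₗ[k] X →ₗ[k] B
  τA_balanced : ∀ x b y, τA (XB x b) y = τA x (BY b y)
  τB_balanced : ∀ y a x, τB (YA y a) x = τB y (AX a x)
  τA_left : ∀ a x y, τA (AX a x) y = a * τA x y
  τA_right : ∀ x y a, τA x (YA y a) = τA x y * a
  τB_left : ∀ b y x, τB (BY b y) x = b * τB y x
  τB_right : ∀ y x b, τB y (XB x b) = τB y x * b
  τA_τB : ∀ x y x', AX (τA x y) x' = XB x (τB y x')
  τB_τA : ∀ y x y', BY (τB y x) y' = YA y (τA x y')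

variable {k : Type*} {G : Type*} {A B X Y : Type*} [CommRing k] [Group G]
  [NonUnitalRing A] [Module k A] [IsScalarTower k A A] [SMulCommClass k A A]
  [NonUnitalRing B] [Module k B] [IsScalarTower k B B] [SMulCommClass k B B]
  [AddCommGroup X] [Module k X] [AddCommGroup Y] [Module k Y]

namespace MoritaContext

variable (M : MoritaContext k A B X Y) (𝒜 : G → Submodule k A) (ℬ : G → Submodule k B)
  (𝒳 : G → Submodule k X) (𝒴 : G → Submodule k Y)

/-- The Morita context is graded by `𝒳` and `𝒴`, the algebras being graded by `𝒜` and `ℬ`; the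
bimodules are unital and the trace maps are surjective. -/
structure IsGraded : Prop where
  isDirectSum_X : IsDirectSum 𝒳
  isDirectSum_Y : IsDirectSum 𝒴
  AX_mem : ∀ s t, ∀ a ∈ 𝒜 s, ∀ x ∈ 𝒳 t, M.AX a x ∈ 𝒳 (s * t)
  XB_mem : ∀ s t, ∀ x ∈ 𝒳 s, ∀ b ∈ ℬ t, M.XB x b ∈ 𝒳 (s * t)
  BY_mem : ∀ s t, ∀ b ∈ ℬ s, ∀ y ∈ 𝒴 t, M.BY b y ∈ 𝒴 (s * t)
  YA_mem : ∀ s t, ∀ y ∈ 𝒴 s, ∀ a ∈ 𝒜 t, M.YA y a ∈ 𝒴 (s * t)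
  τA_mem : ∀ s t, ∀ x ∈ 𝒳 s, ∀ y ∈ 𝒴 t, M.τA x y ∈ 𝒜 (s * t)
  τB_mem : ∀ s t, ∀ y ∈ 𝒴 s, ∀ x ∈ 𝒳 t, M.τB y x ∈ ℬ (s * t)
  AX_unital : Submodule.map₂ M.AX ⊤ ⊤ = ⊤
  XB_unital : Submodule.map₂ M.XB ⊤ ⊤ = ⊤
  BY_unital : Submodule.map₂ M.BY ⊤ ⊤ = ⊤
  YA_unital : Submodule.map₂ M.YA ⊤ ⊤ = ⊤
  τA_surjective : Submodule.map₂ M.τA ⊤ ⊤ = ⊤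
  τB_surjective : Submodule.map₂ M.τB ⊤ ⊤ = ⊤

/-- The graded Morita context is strong: each `X_t` is a unital `(D_t^A, D_{t⁻¹}^B)`-bimodule and
each `Y_t` is a unital `(D_t^B, D_{t⁻¹}^A)`-bimodule. -/
structure IsStrong : Prop where
  AX : ∀ t, Submodule.map₂ M.AX (domainIdeal 𝒜 t) (𝒳 t) = 𝒳 t
  XB : ∀ t, Submodule.map₂ M.XB (𝒳 t) (domainIdeal ℬ t⁻¹) = 𝒳 t
  BY : ∀ t, Submodule.map₂ M.BY (domainIdeal ℬ t) (𝒴 t) = 𝒴 t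
  YA : ∀ t, Submodule.map₂ M.YA (𝒴 t) (domainIdeal 𝒜 t⁻¹) = 𝒴 t

end MoritaContext

/-- Strong-graded-equivalence of `G`-graded algebras `A = ⊕ 𝒜 t` and `B = ⊕ ℬ t`: both are
idempotent with idempotent `D_t`, and there is a strong graded Morita context with surjective trace
maps such that `τA (X_t ⊗ Y_{t⁻¹}) = D_t^A` and `τB (Y_t ⊗ X_{t⁻¹}) = D_t^B` for all `t`. -/
structure StronglyGradedEquivalent
    {k : Type w} {G : Type v} {A : Type u} {B : Type u'} [CommRing k] [Group G]
    [NonUnitalRing A] [Module k A] [IsScalarTower k A A] [SMulCommClass k A A]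
    [NonUnitalRing B] [Module k B] [IsScalarTower k B B] [SMulCommClass k B B]
    (𝒜 : G → Submodule k A) (ℬ : G → Submodule k B) : Prop where
  graded_left : IsGradedAlgebra 𝒜
  graded_right : IsGradedAlgebra ℬ
  idem_left : mulSpan (⊤ : Submodule k A) ⊤ = ⊤
  idem_right : mulSpan (⊤ : Submodule k B) ⊤ = ⊤
  idem_domain_left : ∀ t, mulSpan (domainIdeal 𝒜 t) (domainIdeal 𝒜 t) = domainIdeal 𝒜 t
  idem_domain_right : ∀ t, mulSpan (domainIdeal ℬ t) (domainIdeal ℬ t) = domainIdeal ℬ t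
  exists_context : ∃ (X Y : Type (max u u')) (_ : AddCommGroup X) (_ : Module k X)
    (_ : AddCommGroup Y) (_ : Module k Y) (M : MoritaContext k A B X Y)
    (𝒳 : G → Submodule k X) (𝒴 : G → Submodule k Y),
    M.IsGraded 𝒜 ℬ 𝒳 𝒴 ∧ M.IsStrong 𝒜 ℬ 𝒳 𝒴 ∧
    (∀ t, Submodule.map₂ M.τA (𝒳 t) (𝒴 t⁻¹) = domainIdeal 𝒜 t) ∧
    (∀ t, Submodule.map₂ M.τB (𝒴 t) (𝒳 t⁻¹) = domainIdeal ℬ t)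

end Morita

end PartialCrossed

set_option linter.unusedSectionVars false

namespace PartialCrossed

/-! ### Products of submodules of non-unital algebras -/

section SubmoduleProducts

variable {k : Type*} {A : Type*} [CommRing k] [NonUnitalRing A] [Module k A]
  [IsScalarTower k A A] [SMulCommClass k A A]

/-! The twist is removed by passing to matrices over the crossed product. Let `B` be the crossed
product with components `B_g = D_g δ_g`. The only facts about the twist that survive are that `B` is
graded and that the grading is symmetric, `B_t B_{t⁻¹} B_t = B_t` (`grading_isSymmetric`). Symmetry
alone makes the ideals `B_t B_{t⁻¹}` of `B_1` idempotent and commuting (`domain_idem`,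
`domain_comm`).

In the algebra of finitely supported `G × G`-matrices over `B`, let `b_t` be `B_t` in the position
`(1, 1)`, let `R` be the row with entries in `B_h` and `C` the column with entries in `B_{g⁻¹}`.
Then `R C = b_1`, and `A' = C R` is an algebra. Simultaneous translation of row and column indices
by `g` is an automorphism of the whole matrix algebra, and these automorphisms compose without any
twist. Translation by `g` maps `C b_{g⁻¹} b_g R` onto `C b_g b_{g⁻¹} R`. With these ideals as
domains the translations form a product partial action on `A'`; the main point is
`map_shift_matrixDomain_mul`.

Its skew group algebra embeds back into the matrices: `a δ_g` goes to `a` with columns translated by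
`g⁻¹`, and the component of degree `g` becomes `C b_g R`. All four corners of the Morita context
thus lie in one associative algebra, with components `b_t`, `C b_t R`, `X_t = b_t R` and `Y_t = C
b_t`. The sums are direct because the entry `(g, h)` of a matrix of degree `t` lies in `B_{g⁻¹ t h}`
(`iSupIndep_degree`). Every condition of strong-graded-equivalence is then an identity or inclusion
between products of submodules, following from `R C = b_1` and the symmetry of `b`
(`stronglyGradedEquivalent_of_corner`). -/

theorem mulSpan_le {P Q S : Submodule k A} :
    mulSpan P Q ≤ S ↔ ∀ p ∈ P, ∀ q ∈ Q, p * q ∈ S :=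
  Submodule.map₂_le

/-- The submodules of a non-unital algebra form a semigroup under `mulSpan`. -/
instance submoduleSemigroup : Semigroup (Submodule k A) where
  mul := mulSpan
  mul_assoc P Q S := by
    apply le_antisymm
    · have key : ∀ s ∈ S, mulSpan P Q ≤
          (mulSpan P (mulSpan Q S)).comap ((LinearMap.mul k A).flip s) := fun s hs =>
        mulSpan_le.2 fun p hp q hq => by
          have := Submodule.apply_mem_map₂ (LinearMap.mul k A) hp
            (Submodule.apply_mem_map₂ (LinearMap.mul k A) hq hs)
          simpa [mulSpan, mul_assoc] using this
      exact mulSpan_le.2 fun x hx s hs => key s hs hx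
    · have key : ∀ p ∈ P, mulSpan Q S ≤
          (mulSpan (mulSpan P Q) S).comap (LinearMap.mul k A p) := fun p hp =>
        mulSpan_le.2 fun q hq s hs => by
          have := Submodule.apply_mem_map₂ (LinearMap.mul k A)
            (Submodule.apply_mem_map₂ (LinearMap.mul k A) hp hq) hs
          simpa [mulSpan, mul_assoc] using this
      exact mulSpan_le.2 fun p hp x hx => key p hp hx

theorem mulSpan_eq_mul (P Q : Submodule k A) : mulSpan P Q = P * Q := rfl

theorem submodule_mul_le {P Q S : Submodule k A} :
    P * Q ≤ S ↔ ∀ p ∈ P, ∀ q ∈ Q, p * q ∈ S :=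
  Submodule.map₂_le

theorem mul_mem_submodule_mul {P Q : Submodule k A} {p q : A} (hp : p ∈ P) (hq : q ∈ Q) :
    p * q ∈ P * Q :=
  Submodule.apply_mem_map₂ (LinearMap.mul k A) hp hq

theorem submodule_mul_mono {P P' Q Q' : Submodule k A} (h : P ≤ P') (h' : Q ≤ Q') :
    P * Q ≤ P' * Q' :=
  Submodule.map₂_le_map₂ h h'

theorem iSup_submodule_mul {ι : Sort*} (P : ι → Submodule k A) (Q : Submodule k A) :
    (⨆ i, P i) * Q = ⨆ i, P i * Q :=
  Submodule.map₂_iSup_left _ _ _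

theorem submodule_mul_iSup {ι : Sort*} (P : Submodule k A) (Q : ι → Submodule k A) :
    P * (⨆ i, Q i) = ⨆ i, P * Q i :=
  Submodule.map₂_iSup_right _ _ _

end SubmoduleProducts

/-! ### Bilinear maps induced by the multiplication of an ambient algebra -/

section MulLift

variable {k : Type*} {M P Q S : Type*} [CommRing k] [NonUnitalRing M] [Module k M]
  [IsScalarTower k M M] [SMulCommClass k M M] [AddCommGroup P] [Module k P] [AddCommGroup Q]
  [Module k Q] [AddCommGroup S] [Module k S]
  (i : P →ₗ[k] M) (j : Q →ₗ[k] M) (l : S →ₗ[k] M)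

/-- The bilinear map `f : P × Q → S` with `l (f p q) = i p * j q`, where `l` is injective. -/
noncomputable def mulLift (hl : Function.Injective l) (h : ∀ p q, i p * j q ∈ LinearMap.range l) :
    P →ₗ[k] Q →ₗ[k] S :=
  LinearMap.mk₂ k (fun p q => (LinearEquiv.ofInjective l hl).symm ⟨i p * j q, h p q⟩)
    (fun p p' q => by
      rw [← map_add]
      exact congrArg _ (Subtype.ext ((congrArg (· * j q) (map_add i p p')).trans (add_mul _ _ _))))
    (fun c p q => by
      rw [← map_smul]
      exact congrArg _ (Subtype.ext ((congrArg (· * j q) (map_smul i c p)).trans (smul_mul_assoc _ _ _))))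
    (fun p q q' => by
      rw [← map_add]
      exact congrArg _ (Subtype.ext ((congrArg (i p * ·) (map_add j q q')).trans (mul_add _ _ _))))
    (fun c p q => by
      rw [← map_smul]
      exact congrArg _ (Subtype.ext ((congrArg (i p * ·) (map_smul j c q)).trans (mul_smul_comm _ _ _))))

variable {i j l}

theorem apply_mulLift (hl : Function.Injective l) (h : ∀ p q, i p * j q ∈ LinearMap.range l)
    (p : P) (q : Q) : l (mulLift i j l hl h p q) = i p * j q :=
  congrArg Subtype.val ((LinearEquiv.ofInjective l hl).apply_symm_apply ⟨i p * j q, h p q⟩)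

/-- This translates statements about the spans in a Morita context into statements in the semigroup
of submodules of the ambient algebra, where they can be proved by rewriting. -/
theorem map_map₂_of_apply_eq_mul {f : P →ₗ[k] Q →ₗ[k] S} (hf : ∀ p q, l (f p q) = i p * j q)
    (P' : Submodule k P) (Q' : Submodule k Q) :
    (Submodule.map₂ f P' Q').map l = P'.map i * Q'.map j := by
  apply le_antisymm
  · rw [Submodule.map_le_iff_le_comap, Submodule.map₂_le]
    intro p hp q hq
    rw [Submodule.mem_comap, hf]
    exact mul_mem_submodule_mul (Submodule.mem_map_of_mem hp) (Submodule.mem_map_of_mem hq)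
  · rw [submodule_mul_le]
    rintro _ ⟨p, hp, rfl⟩ _ ⟨q, hq, rfl⟩
    rw [← hf]
    exact Submodule.mem_map_of_mem (Submodule.apply_mem_map₂ f hp hq)

end MulLift

theorem map_submodule_mul {k A M : Type*} [CommRing k] [NonUnitalRing A] [Module k A]
    [IsScalarTower k A A] [SMulCommClass k A A] [NonUnitalRing M] [Module k M]
    [IsScalarTower k M M] [SMulCommClass k M M] {i : A →ₗ[k] M}
    (hi : ∀ a b, i (a * b) = i a * i b) (P Q : Submodule k A) :
    (P * Q).map i = P.map i * Q.map i :=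
  map_map₂_of_apply_eq_mul (f := LinearMap.mul k A) hi P Q

/-! ### Symmetric families of submodules -/

section Symmetric

variable {k : Type*} {G : Type*} {A : Type*} [CommRing k] [Group G] [NonUnitalRing A] [Module k A]
  [IsScalarTower k A A] [SMulCommClass k A A]

/-- A multiplicative family `𝒜` of submodules is symmetric if `𝒜 t 𝒜 t⁻¹ 𝒜 t = 𝒜 t`. -/
structure IsSymmetric (𝒜 : G → Submodule k A) : Prop where
  mul_le : ∀ s t, 𝒜 s * 𝒜 t ≤ 𝒜 (s * t)
  mul_inv_mul : ∀ t, 𝒜 t * 𝒜 t⁻¹ * 𝒜 t = 𝒜 t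

namespace IsSymmetric

variable {𝒜 : G → Submodule k A} (h𝒜 : IsSymmetric 𝒜)
include h𝒜

theorem mul_inv_le (t : G) : 𝒜 t * 𝒜 t⁻¹ ≤ 𝒜 1 := by
  simpa using h𝒜.mul_le t t⁻¹

theorem inv_mul_le (t : G) : 𝒜 t⁻¹ * 𝒜 t ≤ 𝒜 1 := by
  simpa using h𝒜.mul_le t⁻¹ t

theorem mul_inv_mul' (t : G) : 𝒜 t * (𝒜 t⁻¹ * 𝒜 t) = 𝒜 t := by
  rw [← mul_assoc, h𝒜.mul_inv_mul]

theorem one_mul (t : G) : 𝒜 1 * 𝒜 t = 𝒜 t := by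
  apply le_antisymm
  · simpa using h𝒜.mul_le 1 t
  · conv_lhs => rw [← h𝒜.mul_inv_mul t]
    exact submodule_mul_mono (h𝒜.mul_inv_le t) le_rfl

theorem mul_one (t : G) : 𝒜 t * 𝒜 1 = 𝒜 t := by
  apply le_antisymm
  · simpa using h𝒜.mul_le t 1
  · conv_lhs => rw [← h𝒜.mul_inv_mul' t]
    exact submodule_mul_mono le_rfl (h𝒜.inv_mul_le t)

/-- One inclusion is multiplicativity. For the other, expand `𝒜 g` as `𝒜 g * 𝒜 g⁻¹ * 𝒜 g` and absorb
the last factor into `𝒜 (g⁻¹ * h)`, which gives a part of `𝒜 h`. -/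
theorem domain_mul (g h : G) : 𝒜 g * 𝒜 g⁻¹ * 𝒜 h = 𝒜 g * 𝒜 (g⁻¹ * h) := by
  apply le_antisymm
  · rw [mul_assoc]
    exact submodule_mul_mono le_rfl (h𝒜.mul_le _ _)
  · conv_lhs => rw [← h𝒜.mul_inv_mul g, mul_assoc (𝒜 g * 𝒜 g⁻¹)]
    exact submodule_mul_mono le_rfl (by simpa using h𝒜.mul_le g (g⁻¹ * h))

theorem mul_domain (g h : G) : 𝒜 h * (𝒜 g * 𝒜 g⁻¹) = 𝒜 (h * g) * 𝒜 g⁻¹ := by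
  apply le_antisymm
  · rw [← mul_assoc]
    exact submodule_mul_mono (h𝒜.mul_le _ _) le_rfl
  · have e := h𝒜.mul_inv_mul' g⁻¹
    rw [inv_inv] at e
    conv_lhs => rw [← e, ← mul_assoc]
    exact submodule_mul_mono (by simpa using h𝒜.mul_le (h * g) g⁻¹) le_rfl

/-- Both sides equal `𝒜 (g * h) * 𝒜 h⁻¹`. The lemma moves a domain across a component, translating
its index. -/
theorem domain_mul_eq_mul_domain (g h : G) :
    𝒜 (g * h) * 𝒜 (g * h)⁻¹ * 𝒜 g = 𝒜 g * (𝒜 h * 𝒜 h⁻¹) := by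
  rw [h𝒜.domain_mul, h𝒜.mul_domain]
  congr 2
  group

/-- Both sides reduce to `𝒜 h * 𝒜 (h⁻¹ * g) * 𝒜 g⁻¹`; on the left the domain of `g` is first moved
across `𝒜 h`, where it becomes the domain of `h⁻¹ * g`. -/
theorem domain_comm (g h : G) :
    𝒜 g * 𝒜 g⁻¹ * (𝒜 h * 𝒜 h⁻¹) = 𝒜 h * 𝒜 h⁻¹ * (𝒜 g * 𝒜 g⁻¹) := by
  have e := h𝒜.domain_mul_eq_mul_domain h (h⁻¹ * g)
  rw [mul_inv_cancel_left] at e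
  rw [← mul_assoc (𝒜 g * 𝒜 g⁻¹), e, mul_assoc (𝒜 h), h𝒜.domain_mul, ← mul_assoc (𝒜 h * 𝒜 h⁻¹),
    h𝒜.domain_mul, mul_assoc]
  congr 3
  group

theorem domain_idem (g : G) : 𝒜 g * 𝒜 g⁻¹ * (𝒜 g * 𝒜 g⁻¹) = 𝒜 g * 𝒜 g⁻¹ := by
  rw [← mul_assoc, h𝒜.mul_inv_mul]

theorem map {M : Type*} [NonUnitalRing M] [Module k M]
    [IsScalarTower k M M] [SMulCommClass k M M] {i : A →ₗ[k] M}
    (hi : ∀ a b, i (a * b) = i a * i b) : IsSymmetric fun t => (𝒜 t).map i where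
  mul_le s t := by
    rw [← map_submodule_mul hi]
    exact Submodule.map_mono (h𝒜.mul_le s t)
  mul_inv_mul t := by
    rw [← map_submodule_mul hi, ← map_submodule_mul hi, h𝒜.mul_inv_mul]

end IsSymmetric

end Symmetric

/-! ### Morita contexts inside an ambient algebra -/

section Embedded

/-- A Morita context all of whose products are computed in an ambient algebra `M`. -/
noncomputable def MoritaContext.ofEmbeddings {k A B X Y M : Type*} [CommRing k]
    [NonUnitalRing A] [Module k A] [IsScalarTower k A A] [SMulCommClass k A A]
    [NonUnitalRing B] [Module k B] [IsScalarTower k B B] [SMulCommClass k B B]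
    [AddCommGroup X] [Module k X] [AddCommGroup Y] [Module k Y]
    [NonUnitalRing M] [Module k M] [IsScalarTower k M M] [SMulCommClass k M M]
    (iA : A →ₗ[k] M) (iB : B →ₗ[k] M) (iX : X →ₗ[k] M) (iY : Y →ₗ[k] M)
    (hA : Function.Injective iA) (hB : Function.Injective iB) (hX : Function.Injective iX)
    (hY : Function.Injective iY) (mulA : ∀ a b, iA (a * b) = iA a * iA b)
    (mulB : ∀ a b, iB (a * b) = iB a * iB b)
    (hAX : ∀ a x, iA a * iX x ∈ LinearMap.range iX) (hXB : ∀ x b, iX x * iB b ∈ LinearMap.range iX)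
    (hBY : ∀ b y, iB b * iY y ∈ LinearMap.range iY) (hYA : ∀ y a, iY y * iA a ∈ LinearMap.range iY)
    (hXY : ∀ x y, iX x * iY y ∈ LinearMap.range iA)
    (hYX : ∀ y x, iY y * iX x ∈ LinearMap.range iB) : MoritaContext k A B X Y where
  AX := mulLift iA iX iX hX hAX
  XB := mulLift iX iB iX hX hXB
  BY := mulLift iB iY iY hY hBY
  YA := mulLift iY iA iY hY hYA
  AX_mul _ _ _ := hX (by simp only [apply_mulLift, mulA, mul_assoc])
  XB_mul _ _ _ := hX (by simp only [apply_mulLift, mulB, mul_assoc])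
  AX_XB _ _ _ := hX (by simp only [apply_mulLift, mul_assoc])
  BY_mul _ _ _ := hY (by simp only [apply_mulLift, mulB, mul_assoc])
  YA_mul _ _ _ := hY (by simp only [apply_mulLift, mulA, mul_assoc])
  BY_YA _ _ _ := hY (by simp only [apply_mulLift, mul_assoc])
  τA := mulLift iX iY iA hA hXY
  τB := mulLift iY iX iB hB hYX
  τA_balanced _ _ _ := hA (by simp only [apply_mulLift, mul_assoc])
  τB_balanced _ _ _ := hB (by simp only [apply_mulLift, mul_assoc])
  τA_left _ _ _ := hA (by simp only [apply_mulLift, mulA, mul_assoc])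
  τA_right _ _ _ := hA (by simp only [apply_mulLift, mulA, mul_assoc])
  τB_left _ _ _ := hB (by simp only [apply_mulLift, mulB, mul_assoc])
  τB_right _ _ _ := hB (by simp only [apply_mulLift, mulB, mul_assoc])
  τA_τB _ _ _ := hX (by simp only [apply_mulLift, mul_assoc])
  τB_τA _ _ _ := hY (by simp only [apply_mulLift, mul_assoc])

end Embedded

/-! ### Direct sum decompositions -/

section DirectSums

variable {k : Type*} {G : Type*} [CommRing k] {M : Type*} [AddCommGroup M] [Module k M]

/-- Independence of submodules may be checked on coordinates. -/
theorem iSupIndep_of_coordinates {ι : Type*} {N : ι → Type*} [∀ c, AddCommGroup (N c)]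
    [∀ c, Module k (N c)] (φ : ∀ c, M →ₗ[k] N c) (hφ : ∀ x, (∀ c, φ c x = 0) → x = 0)
    {p : G → Submodule k M} (hp : ∀ c, iSupIndep fun t => (p t).map (φ c)) : iSupIndep p := by
  intro t
  rw [Submodule.disjoint_def]
  intro x hx hx'
  refine hφ x fun c => Submodule.disjoint_def.1 (hp c t) _ (Submodule.mem_map_of_mem hx) ?_
  simpa only [Submodule.map_iSup] using Submodule.mem_map_of_mem (f := φ c) hx'

theorem iSupIndep_of_map {N : Type*} [AddCommGroup N] [Module k N] {i : M →ₗ[k] N}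
    (hi : Function.Injective i) {p : G → Submodule k M} (hp : iSupIndep fun t => (p t).map i) :
    iSupIndep p :=
  iSupIndep_of_coordinates (fun _ : Unit => i)
    (fun x hx => hi (by rw [hx (), map_zero])) fun _ => hp

theorem map_comap_subtype_iSup (p : G → Submodule k M) (t : G) :
    ((p t).comap (⨆ t, p t).subtype).map (⨆ t, p t).subtype = p t := by
  rw [Submodule.map_comap_subtype, inf_eq_right]
  exact le_iSup p t

/-- An independent family of submodules decomposes its supremum. -/
theorem isDirectSum_comap_subtype [Group G] {p : G → Submodule k M} (hp : iSupIndep p) :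
    IsDirectSum fun t => (p t).comap (⨆ t, p t).subtype := by
  have hi : Function.Injective (⨆ t, p t).subtype := Subtype.val_injective
  refine ⟨iSupIndep_of_map hi ?_, Submodule.map_injective_of_injective hi ?_⟩
  · simpa only [map_comap_subtype_iSup] using hp
  · rw [Submodule.map_iSup, Submodule.map_top, Submodule.range_subtype]
    simp only [map_comap_subtype_iSup]

end DirectSums

/-! ### Strong-graded-equivalence from a corner -/

section Corner

theorem iSup_mul_iSup_le {k G M : Type*} [CommRing k] [Group G] [NonUnitalRing M] [Module k M]
    [IsScalarTower k M M] [SMulCommClass k M M] {P Q R : G → Submodule k M}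
    (h : ∀ s t, P s * Q t ≤ R (s * t)) : (⨆ t, P t) * (⨆ t, Q t) ≤ ⨆ t, R t := by
  rw [iSup_submodule_mul]
  refine iSup_le fun s => ?_
  rw [submodule_mul_iSup]
  exact iSup_le fun t => (h s t).trans (le_iSup R (s * t))

theorem map₂_top_eq_top {k G P Q S : Type*} [CommRing k] [Group G] [AddCommGroup P] [Module k P]
    [AddCommGroup Q] [Module k Q] [AddCommGroup S] [Module k S] {f : P →ₗ[k] Q →ₗ[k] S}
    {𝒮 : G → Submodule k S} (h𝒮 : IsDirectSum 𝒮)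
    (h : ∀ t, ∃ (P' : Submodule k P) (Q' : Submodule k Q), Submodule.map₂ f P' Q' = 𝒮 t) :
    Submodule.map₂ f ⊤ ⊤ = ⊤ := by
  rw [eq_top_iff, ← h𝒮.2]
  refine iSup_le fun t => ?_
  obtain ⟨P', Q', e⟩ := h t
  rw [← e]
  exact Submodule.map₂_le_map₂ le_top le_top

/-- Let `b` be a symmetric family of submodules of an algebra `M` and `X`, `Y` submodules with
`X Y = b 1`, `b 1 X = X` and `Y b 1 = Y`. Then graded algebras with components `b t` and
`Y b t X`, respectively, are strongly-graded-equivalent. -/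
theorem stronglyGradedEquivalent_of_corner {k : Type w} {G : Type v} {A M : Type u} {B : Type u'}
    [CommRing k] [Group G]
    [NonUnitalRing A] [Module k A] [IsScalarTower k A A] [SMulCommClass k A A]
    [NonUnitalRing B] [Module k B] [IsScalarTower k B B] [SMulCommClass k B B]
    [NonUnitalRing M] [Module k M] [IsScalarTower k M M] [SMulCommClass k M M]
    {iA : A →ₗ[k] M} {iB : B →ₗ[k] M} (hA : Function.Injective iA) (hB : Function.Injective iB)
    (mulA : ∀ a b, iA (a * b) = iA a * iA b) (mulB : ∀ a b, iB (a * b) = iB a * iB b)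
    {b : G → Submodule k M} (hb : IsSymmetric b) {X Y : Submodule k M}
    (hXY : X * Y = b 1) (hbX : b 1 * X = X) (hYb : Y * b 1 = Y)
    {𝒜 : G → Submodule k A} {ℬ : G → Submodule k B} (h𝒜 : IsGradedAlgebra 𝒜)
    (hℬ : IsGradedAlgebra ℬ) (map𝒜 : ∀ t, (𝒜 t).map iA = b t)
    (mapℬ : ∀ t, (ℬ t).map iB = Y * (b t * X))
    (indepX : iSupIndep fun t => b t * X) (indepY : iSupIndep fun t => Y * b t) :
    ∃ (X Y : Type u) (_ : AddCommGroup X) (_ : Module k X)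
    (_ : AddCommGroup Y) (_ : Module k Y) (M : MoritaContext k A B X Y)
    (𝒳 : G → Submodule k X) (𝒴 : G → Submodule k Y),
    M.IsGraded 𝒜 ℬ 𝒳 𝒴 ∧ M.IsStrong 𝒜 ℬ 𝒳 𝒴 ∧
    (∀ t, Submodule.map₂ M.τA (𝒳 t) (𝒴 t⁻¹) = domainIdeal 𝒜 t) ∧
    (∀ t, Submodule.map₂ M.τB (𝒴 t) (𝒳 t⁻¹) = domainIdeal ℬ t) := by
  -- Products are kept right associated from here on. The primed rules are the basic relations
  -- followed by a further factor `Z`, as they occur inside longer products.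
  have hXY' : ∀ Z, X * (Y * Z) = b 1 * Z := fun Z => by rw [← mul_assoc, hXY]
  have h1b' : ∀ t Z, b 1 * (b t * Z) = b t * Z := fun t Z => by rw [← mul_assoc, hb.one_mul]
  have hbb' : ∀ t Z, b t * (b t⁻¹ * (b t * Z)) = b t * Z := fun t Z => by
    rw [← mul_assoc, ← mul_assoc, hb.mul_inv_mul]
  have hle' : ∀ s t Z, b s * (b t * Z) ≤ b (s * t) * Z := fun s t Z => by
    rw [← mul_assoc]
    exact submodule_mul_mono (hb.mul_le s t) le_rfl
  have hYle : ∀ {Z Z'}, Z ≤ Z' → Y * Z ≤ Y * Z' := fun h => submodule_mul_mono le_rfl h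
  set 𝕏 : Submodule k M := ⨆ t, b t * X with h𝕏
  set 𝕐 : Submodule k M := ⨆ t, Y * b t with h𝕐
  have rangeA : LinearMap.range iA = ⨆ t, b t := by
    rw [← Submodule.map_top, ← h𝒜.isDirectSum.2, Submodule.map_iSup]
    simp only [map𝒜]
  have rangeB : LinearMap.range iB = ⨆ t, Y * (b t * X) := by
    rw [← Submodule.map_top, ← hℬ.isDirectSum.2, Submodule.map_iSup]
    simp only [mapℬ]
  have range_mul : ∀ {P Q S : Submodule k M} (_ : P * Q ≤ S) {p q}, p ∈ P → q ∈ Q → p * q ∈ S := by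
    intro P Q S h p q hp hq
    exact h (mul_mem_submodule_mul hp hq)
  have hX : Function.Injective 𝕏.subtype := Subtype.val_injective
  have hY : Function.Injective 𝕐.subtype := Subtype.val_injective
  let C : MoritaContext k A B 𝕏 𝕐 := MoritaContext.ofEmbeddings iA iB 𝕏.subtype 𝕐.subtype
    hA hB hX hY mulA mulB
    (fun a x => by
      rw [Submodule.range_subtype]
      refine range_mul ?_ (LinearMap.mem_range_self iA a) x.2
      rw [rangeA]
      exact iSup_mul_iSup_le fun s t => hle' s t X)
    (fun x b => by
      rw [Submodule.range_subtype]
      refine range_mul ?_ x.2 (LinearMap.mem_range_self iB b)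
      rw [rangeB]
      exact iSup_mul_iSup_le fun s t => by
        rw [mul_assoc, hXY', h1b']
        exact hle' s t X)
    (fun b y => by
      rw [Submodule.range_subtype]
      refine range_mul ?_ (LinearMap.mem_range_self iB b) y.2
      rw [rangeB]
      exact iSup_mul_iSup_le fun s t => by
        rw [mul_assoc, mul_assoc, hXY', hb.one_mul]
        exact hYle (hb.mul_le s t))
    (fun y a => by
      rw [Submodule.range_subtype]
      refine range_mul ?_ y.2 (LinearMap.mem_range_self iA a)
      rw [rangeA]
      exact iSup_mul_iSup_le fun s t => by
        rw [mul_assoc]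
        exact hYle (hb.mul_le s t))
    (fun x y => by
      rw [rangeA]
      refine range_mul (iSup_mul_iSup_le fun s t => ?_) x.2 y.2
      rw [mul_assoc, hXY', hb.one_mul]
      exact hb.mul_le s t)
    (fun y x => by
      rw [rangeB]
      refine range_mul (iSup_mul_iSup_le fun s t => ?_) y.2 x.2
      rw [mul_assoc]
      exact hYle (hle' s t X))
  have mapAX := map_map₂_of_apply_eq_mul (f := C.AX) (i := iA) (j := 𝕏.subtype) (l := 𝕏.subtype)
    fun a x => apply_mulLift _ _ a x
  have mapXB := map_map₂_of_apply_eq_mul (f := C.XB) (i := 𝕏.subtype) (j := iB) (l := 𝕏.subtype)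
    fun a x => apply_mulLift _ _ a x
  have mapBY := map_map₂_of_apply_eq_mul (f := C.BY) (i := iB) (j := 𝕐.subtype) (l := 𝕐.subtype)
    fun a x => apply_mulLift _ _ a x
  have mapYA := map_map₂_of_apply_eq_mul (f := C.YA) (i := 𝕐.subtype) (j := iA) (l := 𝕐.subtype)
    fun a x => apply_mulLift _ _ a x
  have mapτA := map_map₂_of_apply_eq_mul (f := C.τA) (i := 𝕏.subtype) (j := 𝕐.subtype) (l := iA)
    fun a x => apply_mulLift _ _ a x
  have mapτB := map_map₂_of_apply_eq_mul (f := C.τB) (i := 𝕐.subtype) (j := 𝕏.subtype) (l := iB)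
    fun a x => apply_mulLift _ _ a x
  let 𝒳 : G → Submodule k 𝕏 := fun t => (b t * X).comap 𝕏.subtype
  let 𝒴 : G → Submodule k 𝕐 := fun t => (Y * b t).comap 𝕐.subtype
  have map𝒳 : ∀ t, (𝒳 t).map 𝕏.subtype = b t * X := map_comap_subtype_iSup _
  have map𝒴 : ∀ t, (𝒴 t).map 𝕐.subtype = Y * b t := map_comap_subtype_iSup _
  have ds𝒳 : IsDirectSum 𝒳 := isDirectSum_comap_subtype indepX
  have ds𝒴 : IsDirectSum 𝒴 := isDirectSum_comap_subtype indepY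
  have mapDA : ∀ t, (domainIdeal 𝒜 t).map iA = b t * b t⁻¹ := fun t => by
    rw [domainIdeal, mulSpan_eq_mul, map_submodule_mul mulA, map𝒜, map𝒜]
  have mapDB : ∀ t, (domainIdeal ℬ t).map iB = Y * (b t * (b t⁻¹ * X)) := fun t => by
    rw [domainIdeal, mulSpan_eq_mul, map_submodule_mul mulB, mapℬ, mapℬ, mul_assoc, mul_assoc,
      hXY', h1b']
  have leX := fun {P Q : Submodule k 𝕏} => (Submodule.map_le_map_iff_of_injective hX P Q).1
  have leY := fun {P Q : Submodule k 𝕐} => (Submodule.map_le_map_iff_of_injective hY P Q).1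
  have leA := fun {P Q : Submodule k A} => (Submodule.map_le_map_iff_of_injective hA P Q).1
  have leB := fun {P Q : Submodule k B} => (Submodule.map_le_map_iff_of_injective hB P Q).1
  have eqX := Submodule.map_injective_of_injective hX
  have eqY := Submodule.map_injective_of_injective hY
  have eqA := Submodule.map_injective_of_injective hA
  have eqB := Submodule.map_injective_of_injective hB
  refine ⟨𝕏, 𝕐, inferInstance, inferInstance, inferInstance, inferInstance, C, 𝒳, 𝒴,
    { isDirectSum_X := ds𝒳
      isDirectSum_Y := ds𝒴
      AX_mem := fun s t => Submodule.map₂_le.1 (leX ?_)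
      XB_mem := fun s t => Submodule.map₂_le.1 (leX ?_)
      BY_mem := fun s t => Submodule.map₂_le.1 (leY ?_)
      YA_mem := fun s t => Submodule.map₂_le.1 (leY ?_)
      τA_mem := fun s t => Submodule.map₂_le.1 (leA ?_)
      τB_mem := fun s t => Submodule.map₂_le.1 (leB ?_)
      -- Degree `1` suffices for unitality and surjectivity: `b 1` and `Y * (b 1 * X)` act as
      -- identities on all components, and `X_t Y_1 = b t`, `Y_1 X_t = Y * (b t * X)`.
      AX_unital := map₂_top_eq_top ds𝒳 fun t => ⟨𝒜 1, 𝒳 t, eqX ?_⟩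
      XB_unital := map₂_top_eq_top ds𝒳 fun t => ⟨𝒳 t, ℬ 1, eqX ?_⟩
      BY_unital := map₂_top_eq_top ds𝒴 fun t => ⟨ℬ 1, 𝒴 t, eqY ?_⟩
      YA_unital := map₂_top_eq_top ds𝒴 fun t => ⟨𝒴 t, 𝒜 1, eqY ?_⟩
      τA_surjective := map₂_top_eq_top h𝒜.isDirectSum fun t => ⟨𝒳 t, 𝒴 1, eqA ?_⟩
      τB_surjective := map₂_top_eq_top hℬ.isDirectSum fun t => ⟨𝒴 1, 𝒳 t, eqB ?_⟩ },
    { AX := fun t => eqX ?_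
      XB := fun t => eqX ?_
      BY := fun t => eqY ?_
      YA := fun t => eqY ?_ },
    fun t => eqA ?_, fun t => eqB ?_⟩
  -- After application of the injective embeddings, each goal compares two products of `X`, `Y` and
  -- the `b t`; the relations above bring both to a common form or bound one by the other.
  all_goals
    simp only [mapAX, mapXB, mapBY, mapYA, mapτA, mapτB, mapDA, mapDB, map𝒜, mapℬ, map𝒳, map𝒴,
      mul_assoc, hXY, hXY', hbX, hYb, hb.one_mul, hb.mul_one, h1b', hbb',
      inv_inv, hb.mul_inv_mul', hle', hb.mul_le, hYle]

end Corner

/-! ### The grading of a crossed product -/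

namespace TwistedPartialAction

variable {k : Type w} {G : Type v} {A : Type u} [CommRing k] [Group G] [NonUnitalRing A]
  [Module k A] [IsScalarTower k A A] [SMulCommClass k A A] (T : TwistedPartialAction k G A)

theorem delta_congr {g g' : G} (h : g = g') {a : T.D g} {a' : T.D g'} (ha : (a : A) = a') :
    T.delta g a = T.delta g' a' :=
  T.lof_congr h ha

theorem grading_isDirectSum : IsDirectSum T.grading := by
  classical
  let π : ∀ g, T.CrossedProduct →ₗ[k] T.D g := DirectSum.component k G (fun g => T.D g)
  refine ⟨fun g => ?_, ?_⟩
  · rw [Submodule.disjoint_def]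
    rintro _ ⟨a, rfl⟩ hx
    have hle : ⨆ h, ⨆ (_ : h ≠ g), T.grading h ≤ LinearMap.ker (π g) := by
      refine iSup₂_le fun h hg => ?_
      rintro _ ⟨c, rfl⟩
      exact (DirectSum.component.of (R := k) (M := fun g => T.D g) g h c).trans (dif_neg hg)
    have h0 : π g (T.delta g a) = 0 := hle hx
    have h1 : π g (T.delta g a) = a := DirectSum.component.lof_self (R := k) (M := fun g => T.D g) g a
    rw [← h1, h0, map_zero]
  · rw [eq_top_iff]
    rintro x -
    induction x using DirectSum.induction_on with
    | zero => exact zero_mem _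
    | add x y hx hy => exact add_mem hx hy
    | of g a => exact Submodule.mem_iSup_of_mem g ⟨a, rfl⟩

theorem grading_isGradedAlgebra : IsGradedAlgebra T.grading where
  isDirectSum := T.grading_isDirectSum
  mul_mem := by
    rintro g h _ ⟨a, rfl⟩ _ ⟨b, rfl⟩
    rw [delta_mul_delta]
    exact ⟨_, rfl⟩

/-- The map `a ↦ α g a · w g h` from `D g⁻¹ D h` onto `D g D (g h)`. -/
theorem exists_w_αRes_eq (g h : G) (y : ↥(T.D g * T.D (g * h))) :
    ∃ x : ↥(T.D g⁻¹ * T.D h), (T.w g h).val.R (T.αRes g h x) = y := by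
  -- As the multiplier is invertible, it suffices to find a preimage of `y * w⁻¹` under `α g`.
  obtain ⟨x, hx, e⟩ := (Set.ext_iff.1 (T.α_image g h)
    ((↑(T.w g h)⁻¹ : Multiplier k ↥(T.D g * T.D (g * h))).R y : A)).2 (Subtype.prop _)
  exact ⟨⟨x, hx⟩, (congrArg _ (Subtype.ext e)).trans (Multiplier.R_R_inv _ y)⟩

/-- The map `x ↦ α g x · w g h` sends `D g⁻¹ D h` onto `D g D (g h)`, and on a product `y * z` its
value is the coefficient of `(α g y δ_g) (z δ_h)`. Hence products of homogeneous elements span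
everything that the axioms allow. -/
theorem grading_mul (g h : G) :
    T.grading g * T.grading h =
      ((T.D g * T.D (g * h)).toSubmodule.comap (T.D (g * h)).toSubmodule.subtype).map
        (T.delta (g * h)) := by
  apply le_antisymm
  · rw [submodule_mul_le]
    rintro _ ⟨a, rfl⟩ _ ⟨b, rfl⟩
    rw [delta_mul_delta]
    refine Submodule.mem_map_of_mem ?_
    change (T.mulComp g h a b : A) ∈ T.D g * T.D (g * h)
    rw [mulComp_apply]
    exact Subtype.prop _
  · rintro _ ⟨⟨c, hc'⟩, hc, rfl⟩
    replace hc : c ∈ T.D g * T.D (g * h) := hc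
    obtain ⟨x, hx⟩ := T.exists_w_αRes_eq g h ⟨c, hc⟩
    let f : ↥(T.D g⁻¹ * T.D h) →ₗ[k] T.CrossedProduct :=
      T.delta (g * h) ∘ₗ AlgIdeal.incl (AlgIdeal.mul_le_right (T.D g) (T.D (g * h))) ∘ₗ
        (T.w g h).val.R ∘ₗ T.αRes g h
    have hf : T.delta (g * h) ⟨c, hc'⟩ = f x :=
      congrArg (T.delta (g * h)) (Subtype.ext
        (congrArg (Subtype.val : ↥(T.D g * T.D (g * h)) → A) hx.symm))
    -- Since `D g⁻¹ D h` is spanned by products `y * z`, it is enough to evaluate `f` on these; the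
    -- image under the inclusion serves to carry the membership proof along.
    have key : (T.D g⁻¹ * T.D h).toSubmodule ≤
        ((T.grading g * T.grading h).comap f).map (T.D g⁻¹ * T.D h).toSubmodule.subtype := by
      refine AlgIdeal.mul_le_submodule fun y hy z hz => ?_
      refine ⟨⟨y * z, AlgIdeal.mul_mem_mul hy hz⟩, ?_, rfl⟩
      have := mul_mem_submodule_mul (P := T.grading g) (Q := T.grading h)
        ⟨T.α g ⟨y, hy⟩, rfl⟩ ⟨⟨z, hz⟩, rfl⟩
      rw [delta_mul_delta] at this
      change f _ ∈ T.grading g * T.grading h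
      convert this using 1
      refine congrArg _ (Subtype.ext ?_)
      change y * z = ((T.α g).symm (T.α g ⟨y, hy⟩) : A) * z
      rw [LinearEquiv.symm_apply_apply]
    obtain ⟨x', hx', e⟩ := key x.2
    rw [hf, ← show x' = x from Subtype.ext e]
    exact hx'

/-- For the nontrivial inclusion, `D g` is spanned by products `y * z` of its elements, and `y z δ_g
= (y δ_1) (z δ_g)`, where `y δ_1` lies in the product of the components of degrees `g` and `g⁻¹` by
`grading_mul`. The later construction uses the twist through nothing but this and the graded algebra
structure. -/
theorem grading_isSymmetric : IsSymmetric T.grading where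
  mul_le g h := submodule_mul_le.2 (T.grading_isGradedAlgebra.mul_mem g h)
  mul_inv_mul g := by
    apply le_antisymm
    · have := submodule_mul_mono (submodule_mul_le.2 (T.grading_isGradedAlgebra.mul_mem g g⁻¹))
        (le_refl (T.grading g))
      refine this.trans ((submodule_mul_le.2
        (T.grading_isGradedAlgebra.mul_mem (g * g⁻¹) g)).trans_eq ?_)
      rw [inv_mul_cancel_right]
    · rintro _ ⟨a, rfl⟩
      have ha : (a : A) ∈ (T.D g * T.D g).toSubmodule := by
        rw [AlgIdeal.mem_toSubmodule, T.D_idem]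
        exact a.2
      have key : (T.D g * T.D g).toSubmodule ≤
          ((T.grading g * T.grading g⁻¹ * T.grading g).comap (T.delta g)).map
            (T.D g).toSubmodule.subtype := by
        refine AlgIdeal.mul_le_submodule fun y hy z hz => ?_
        refine ⟨⟨y * z, (T.D g).mul_mem_right z hy⟩, ?_, rfl⟩
        -- `grading_mul` yields the degree in the form `g * g⁻¹`; the element is transported to
        -- degree `1` afterwards.
        have hy' : T.delta (g * g⁻¹) ⟨y, by rw [mul_inv_cancel]; exact T.D_one y⟩ ∈
            T.grading g * T.grading g⁻¹ := by
          rw [grading_mul]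
          refine Submodule.mem_map_of_mem ?_
          change y ∈ T.D g * T.D (g * g⁻¹)
          have : T.D g ≤ T.D g * T.D (g * g⁻¹) := by
            conv_lhs => rw [← T.D_idem]
            refine AlgIdeal.mul_mono le_rfl fun x _ => ?_
            rw [mul_inv_cancel]
            exact T.D_one x
          exact this hy
        have hy1 : T.delta 1 ⟨y, T.D_one y⟩ ∈ T.grading g * T.grading g⁻¹ := by
          rwa [T.delta_congr (mul_inv_cancel g) (a' := ⟨y, T.D_one y⟩) rfl] at hy'
        have := mul_mem_submodule_mul hy1 (show T.delta g ⟨z, hz⟩ ∈ T.grading g from ⟨_, rfl⟩)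
        rw [delta_mul_delta] at this
        change T.delta g _ ∈ T.grading g * T.grading g⁻¹ * T.grading g
        convert this using 1
        refine T.delta_congr (one_mul g).symm ?_
        rw [mulComp_apply, T.w_one_left]
        change y * z = (T.α 1 _ : A)
        rw [T.α_one]
        have : ((T.α 1).symm ⟨y, T.D_one y⟩ : A) = y := by
          rw [← T.α_one, LinearEquiv.apply_symm_apply]
        change y * z = _ * z
        rw [this]
      obtain ⟨x, hx, e⟩ := key ha
      rw [← show x = a from Subtype.ext e]
      exact hx

@[elab_as_elim]
theorem induction_delta {p : T.CrossedProduct → Prop} (x : T.CrossedProduct) (zero : p 0)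
    (add : ∀ x y, p x → p y → p (x + y)) (delta : ∀ g a, p (T.delta g a)) : p x := by
  classical
  exact DirectSum.induction_on (β := fun g => T.D g) x zero delta add

/-- A linear map on a crossed product is multiplicative if it is so on homogeneous elements. -/
theorem map_mul_of_delta {M : Type*} [NonUnitalRing M] [Module k M] [IsScalarTower k M M]
    [SMulCommClass k M M] {f : T.CrossedProduct →ₗ[k] M}
    (hf : ∀ g h a b, f (T.delta g a * T.delta h b) = f (T.delta g a) * f (T.delta h b))
    (x y : T.CrossedProduct) : f (x * y) = f x * f y := by
  induction x using induction_delta with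
  | zero => simp
  | add x x' hx hx' => rw [add_mul, map_add, map_add, add_mul, hx, hx']
  | delta g a =>
    induction y using induction_delta with
    | zero => simp
    | add y y' hy hy' => rw [mul_add, map_add, map_add, mul_add, hy, hy']
    | delta h b => exact hf g h a b

/-- A linear map on a crossed product which is injective on the homogeneous components and has
independent images of these is injective. -/
theorem injective_of_delta {M : Type*} [AddCommGroup M] [Module k M]
    {f : T.CrossedProduct →ₗ[k] M}
    (hf : ∀ g a, f (T.delta g a) = 0 → a = 0)
    (indep : iSupIndep fun g => (T.grading g).map f) : Function.Injective f := by
  classical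
  rw [injective_iff_map_eq_zero]
  intro x hx
  let y : DirectSum G fun g => T.D g := x
  have hy : ∑ g ∈ DFinsupp.support y, T.delta g (y g) = x := DirectSum.sum_support_of y
  rw [← hy, map_sum] at hx
  rw [← hy]
  refine Finset.sum_eq_zero fun g hg => ?_
  have := iSupIndep_iff_finsetSum_eq_zero_imp_eq_zero _ |>.1 indep (DFinsupp.support y)
    (fun g => f (T.delta g (y g))) (fun g _ => Submodule.mem_map_of_mem ⟨_, rfl⟩) hx g hg
  rw [hf g _ this, map_zero]

end TwistedPartialAction

/-! ### Finitely supported matrices -/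

/-- The finitely supported `ι × ι`-matrices with entries in `B`. -/
@[nolint unusedArguments]
def FinMatrix (_k : Type*) (ι : Type*) (B : Type*) [Zero B] := ι × ι →₀ B

namespace FinMatrix

section Ring

variable {k : Type*} {ι : Type*} {B : Type*} [CommRing k] [NonUnitalRing B] [Module k B]

noncomputable instance : AddCommGroup (FinMatrix k ι B) :=
  inferInstanceAs (AddCommGroup (ι × ι →₀ B))

noncomputable instance : Module k (FinMatrix k ι B) :=
  inferInstanceAs (Module k (ι × ι →₀ B))

/-- The matrix with the single entry `b` in row `i` and column `j`. -/
noncomputable def entry (i j : ι) : B →ₗ[k] FinMatrix k ι B := Finsupp.lsingle (i, j)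

/-- The entry of a matrix in row `p.1` and column `p.2`. -/
def coeff (p : ι × ι) : FinMatrix k ι B →ₗ[k] B := Finsupp.lapply p

theorem coeff_entry_same (i j : ι) (b : B) : coeff (k := k) (i, j) (entry i j b) = b :=
  Finsupp.single_eq_same

theorem coeff_entry_of_ne {i j : ι} {p : ι × ι} (h : p ≠ (i, j)) (b : B) :
    coeff (k := k) p (entry i j b) = 0 :=
  Finsupp.single_eq_of_ne h

theorem eq_zero_of_coeff {x : FinMatrix k ι B} (h : ∀ p, coeff p x = 0) : x = 0 :=
  Finsupp.ext h

theorem entry_injective (i j : ι) : Function.Injective (entry (k := k) (B := B) i j) :=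
  Finsupp.single_injective _

@[elab_as_elim]
theorem induction_entry {p : FinMatrix k ι B → Prop} (x : FinMatrix k ι B) (zero : p 0)
    (add : ∀ x y, p x → p y → p (x + y)) (entry : ∀ i j b, p (entry i j b)) : p x :=
  Finsupp.induction_linear x zero add fun q b => entry q.1 q.2 b

/-- The linear map on matrices with prescribed values on the single entry matrices. -/
noncomputable def lift {N : Type*} [AddCommGroup N] [Module k N] (f : ι → ι → B →ₗ[k] N) :
    FinMatrix k ι B →ₗ[k] N :=
  Finsupp.lsum k fun p : ι × ι => f p.1 p.2

theorem lift_entry {N : Type*} [AddCommGroup N] [Module k N] (f : ι → ι → B →ₗ[k] N) (i j : ι)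
    (b : B) : lift f (entry i j b) = f i j b :=
  Finsupp.lsum_single k (fun p : ι × ι => f p.1 p.2) (i, j) b

variable [IsScalarTower k B B] [SMulCommClass k B B]

open scoped Classical in
/-- Matrix multiplication as a bilinear map. -/
noncomputable def mulHom : FinMatrix k ι B →ₗ[k] FinMatrix k ι B →ₗ[k] FinMatrix k ι B :=
  lift fun i j => LinearMap.flip <| lift fun j' l =>
    if j = j' then ((LinearMap.mul k B).compr₂ (entry i l)).flip else 0

theorem mulHom_entry_entry_same (i j l : ι) (a b : B) :
    mulHom (k := k) (entry i j a) (entry j l b) = entry i l (a * b) := by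
  rw [mulHom, lift_entry, LinearMap.flip_apply, lift_entry, if_pos rfl]
  rfl

theorem mulHom_entry_entry_of_ne {i j j' l : ι} (h : j ≠ j') (a b : B) :
    mulHom (k := k) (entry i j a) (entry j' l b) = 0 := by
  rw [mulHom, lift_entry, LinearMap.flip_apply, lift_entry, if_neg h, LinearMap.zero_apply]
  rfl

theorem mulHom_assoc (x y z : FinMatrix k ι B) :
    mulHom (mulHom x y) z = mulHom x (mulHom y z) := by
  induction x using induction_entry with
  | zero => simp
  | add x x' hx hx' => simp only [map_add, LinearMap.add_apply, hx, hx']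
  | entry i j a =>
    induction y using induction_entry with
    | zero => simp
    | add y y' hy hy' => simp only [map_add, LinearMap.add_apply, hy, hy']
    | entry j' l b =>
      induction z using induction_entry with
      | zero => simp
      | add z z' hz hz' => simp only [map_add, hz, hz']
      | entry l' m c =>
        by_cases hj : j = j' <;> by_cases hl : l = l'
        · subst hj hl
          simp only [mulHom_entry_entry_same, mul_assoc]
        · subst hj
          simp only [mulHom_entry_entry_same, mulHom_entry_entry_of_ne hl, map_zero]
        · subst hl
          simp only [mulHom_entry_entry_same, mulHom_entry_entry_of_ne hj, map_zero,
            LinearMap.zero_apply]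
        · simp only [mulHom_entry_entry_of_ne hl, mulHom_entry_entry_of_ne hj, map_zero,
            LinearMap.zero_apply]

/-- The multiplication comes from the `k`-bilinear map `mulHom`, which is why the scalars are part
of the type `FinMatrix k ι B`. -/
noncomputable instance : NonUnitalRing (FinMatrix k ι B) :=
  { (inferInstance : AddCommGroup (FinMatrix k ι B)) with
    mul := fun x y => mulHom x y
    left_distrib := fun x y z => (mulHom x).map_add y z
    right_distrib := fun x y z => mulHom.map_add₂ x y z
    zero_mul := fun x => mulHom.map_zero₂ x
    mul_zero := fun x => (mulHom x).map_zero
    mul_assoc := mulHom_assoc }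

instance : IsScalarTower k (FinMatrix k ι B) (FinMatrix k ι B) :=
  ⟨fun r x y => mulHom.map_smul₂ r x y⟩

instance : SMulCommClass k (FinMatrix k ι B) (FinMatrix k ι B) :=
  ⟨fun r x y => ((mulHom x).map_smul r y).symm⟩

theorem entry_mul_entry_same (i j l : ι) (a b : B) :
    entry (k := k) i j a * entry j l b = entry i l (a * b) :=
  mulHom_entry_entry_same i j l a b

theorem entry_mul_entry_of_ne {i j j' l : ι} (h : j ≠ j') (a b : B) :
    entry (k := k) i j a * entry j' l b = 0 :=
  mulHom_entry_entry_of_ne h a b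

theorem map_entry_mul_map_entry (i j l : ι) (P Q : Submodule k B) :
    P.map (entry i j) * Q.map (entry j l) = (P * Q).map (entry i l) :=
  (map_map₂_of_apply_eq_mul (f := LinearMap.mul k B)
    (fun a b => (entry_mul_entry_same i j l a b).symm) P Q).symm

theorem map_entry_mul_map_entry_of_ne {i j j' l : ι} (h : j ≠ j') (P Q : Submodule k B) :
    P.map (entry i j) * Q.map (entry j' l) = ⊥ := by
  rw [eq_bot_iff, submodule_mul_le]
  rintro _ ⟨a, -, rfl⟩ _ ⟨b, -, rfl⟩
  exact entry_mul_entry_of_ne h a b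

end Ring

/-! ### Translations of row and column indices -/

section Shift

variable {k : Type*} {G : Type*} {B : Type*} [CommRing k] [Group G] [NonUnitalRing B] [Module k B]

/-- Translation of the row indices by `s` and of the column indices by `t`. -/
noncomputable def shift (s t : G) : FinMatrix k G B ≃ₗ[k] FinMatrix k G B :=
  Finsupp.domLCongr ((Equiv.mulLeft s).prodCongr (Equiv.mulLeft t))

theorem shift_entry (s t g h : G) (b : B) :
    shift (k := k) s t (entry g h b) = entry (s * g) (t * h) b :=
  Finsupp.domLCongr_single _ _ _

theorem map_shift_map_entry (s t g h : G) (P : Submodule k B) :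
    (P.map (entry g h)).map (shift s t).toLinearMap = P.map (entry (s * g) (t * h)) := by
  rw [← Submodule.map_comp]
  congr 1
  exact LinearMap.ext fun b => shift_entry s t g h b

theorem shift_shift (s t s' t' : G) (x : FinMatrix k G B) :
    shift s t (shift s' t' x) = shift (s * s') (t * t') x := by
  induction x using induction_entry with
  | zero => simp
  | add x y hx hy => simp only [map_add, hx, hy]
  | entry i j b => simp only [shift_entry, mul_assoc]

theorem shift_one_one (x : FinMatrix k G B) : shift 1 1 x = x := by
  induction x using induction_entry with
  | zero => simp
  | add x y hx hy => simp only [map_add, hx, hy]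
  | entry i j b => simp only [shift_entry, one_mul]

theorem map_shift_one_one (P : Submodule k (FinMatrix k G B)) :
    P.map (shift (1 : G) 1).toLinearMap = P := by
  convert Submodule.map_id P
  exact LinearMap.ext fun x => shift_one_one x

variable [IsScalarTower k B B] [SMulCommClass k B B]

/-- Formally, `shift s t x` is `λ_s x λ_t⁻¹` with permutation matrices `λ`, so the inner
translations cancel. For `r = s = t` this says that simultaneous translation is multiplicative. -/
theorem shift_mul_shift (r s t : G) (x y : FinMatrix k G B) :
    shift r s x * shift s t y = shift r t (x * y) := by
  induction x using induction_entry with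
  | zero => simp
  | add x x' hx hx' => simp only [map_add, add_mul, hx, hx']
  | entry i j a =>
    induction y using induction_entry with
    | zero => simp
    | add y y' hy hy' => simp only [map_add, mul_add, hy, hy']
    | entry j' l b =>
      by_cases hj : j = j'
      · subst hj
        simp only [shift_entry, entry_mul_entry_same]
      · rw [shift_entry, shift_entry, entry_mul_entry_of_ne hj,
          entry_mul_entry_of_ne (mul_right_injective s |>.ne hj), map_zero]

theorem map_shift_mul (r s t : G) (P Q : Submodule k (FinMatrix k G B)) :
    (P * Q).map (shift r t).toLinearMap =
      P.map (shift r s).toLinearMap * Q.map (shift s t).toLinearMap :=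
  map_map₂_of_apply_eq_mul (f := LinearMap.mul k (FinMatrix k G B))
    (fun x y => (shift_mul_shift r s t x y).symm) P Q

end Shift

/-! ### The corner of a graded algebra in its matrix algebra -/

section Corner

variable {k : Type*} {G : Type*} {B : Type*} [CommRing k] [Group G] [NonUnitalRing B] [Module k B]
  (ℬ : G → Submodule k B)

/-- The matrices of degree `t`: the entry in row `g` and column `h` has degree `g⁻¹ * t * h`. -/
noncomputable def degree (t : G) : Submodule k (FinMatrix k G B) :=
  ⨅ p : G × G, (ℬ (p.1⁻¹ * t * p.2)).comap (coeff p)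

/-- The component `ℬ t` placed in row `1` and column `1`. -/
noncomputable def corner (t : G) : Submodule k (FinMatrix k G B) := (ℬ t).map (entry 1 1)

/-- The matrices in row `1` whose entry in column `h` lies in `ℬ h`. -/
noncomputable def row : Submodule k (FinMatrix k G B) := ⨆ h, (ℬ h).map (entry 1 h)

/-- The matrices in column `1` whose entry in row `g` lies in `ℬ g⁻¹`. -/
noncomputable def column : Submodule k (FinMatrix k G B) := ⨆ g, (ℬ g⁻¹).map (entry g 1)

variable {ℬ}

/-- At a fixed position `(g, h)` the map `t ↦ g⁻¹ * t * h` is injective, so different degrees have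
their entries in different components of `ℬ`. -/
theorem iSupIndep_degree (hℬ : iSupIndep ℬ) : iSupIndep (degree ℬ) := by
  refine iSupIndep_of_coordinates coeff (fun x => eq_zero_of_coeff) fun p => ?_
  have hinj : Function.Injective fun t : G => p.1⁻¹ * t * p.2 := fun s t h => by simpa using h
  refine (hℬ.comp hinj).mono fun t => ?_
  rw [Submodule.map_le_iff_le_comap]
  exact iInf_le _ p

theorem map_entry_le_degree {P : Submodule k B} {g h t : G} (hP : P ≤ ℬ (g⁻¹ * t * h)) :
    P.map (entry g h) ≤ degree ℬ t := by
  rintro _ ⟨b, hb, rfl⟩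
  refine (Submodule.mem_iInf _).2 fun p => ?_
  rw [Submodule.mem_comap]
  by_cases hp : p = (g, h)
  · subst hp
    rw [coeff_entry_same]
    exact hP hb
  · rw [coeff_entry_of_ne hp]
    exact zero_mem _

variable [IsScalarTower k B B] [SMulCommClass k B B]

theorem map_entry_mul_row (P : Submodule k B) :
    P.map (entry 1 1) * row ℬ = ⨆ h, (P * ℬ h).map (entry 1 h) := by
  simp only [row, submodule_mul_iSup, map_entry_mul_map_entry]

theorem column_mul_map_entry (P : Submodule k B) :
    column ℬ * P.map (entry 1 1) = ⨆ g, (ℬ g⁻¹ * P).map (entry g 1) := by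
  simp only [column, iSup_submodule_mul, map_entry_mul_map_entry]

theorem corner_mul_row (t : G) : corner ℬ t * row ℬ = ⨆ h, (ℬ t * ℬ h).map (entry 1 h) :=
  map_entry_mul_row _

theorem column_mul_corner (t : G) :
    column ℬ * corner ℬ t = ⨆ g, (ℬ g⁻¹ * ℬ t).map (entry g 1) :=
  column_mul_map_entry _

theorem corner_mul_corner (s t : G) :
    corner ℬ s * corner ℬ t = (ℬ s * ℬ t).map (entry 1 1) :=
  map_entry_mul_map_entry _ _ _ _ _

variable (hℬ : IsSymmetric ℬ)
include hℬ

theorem corner_isSymmetric : IsSymmetric (corner ℬ) :=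
  hℬ.map fun a b => (entry_mul_entry_same 1 1 1 a b).symm

/-- Only equal indices contribute, which leaves the sum of the `ℬ h * ℬ h⁻¹`. Each summand lies in
`ℬ 1`, and the one with `h = 1` is all of it. -/
theorem row_mul_column : row ℬ * column ℬ = corner ℬ 1 := by
  apply le_antisymm
  · simp only [row, column, iSup_submodule_mul, submodule_mul_iSup, iSup_le_iff]
    intro g h
    by_cases hgh : h = g
    · subst hgh
      rw [map_entry_mul_map_entry]
      exact Submodule.map_mono (hℬ.mul_inv_le h)
    · rw [map_entry_mul_map_entry_of_ne hgh]
      exact bot_le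
  · have h1 := map_entry_mul_map_entry (k := k) (1 : G) 1 1 (ℬ 1) (ℬ 1⁻¹)
    rw [inv_one, hℬ.mul_one] at h1
    rw [corner, ← h1]
    refine submodule_mul_mono (le_iSup (fun h => (ℬ h).map (entry 1 h)) 1) ?_
    have h2 := le_iSup (fun g => (ℬ g⁻¹).map (entry (k := k) g (1 : G))) 1
    rw [inv_one] at h2
    exact h2

theorem corner_one_mul_row : corner ℬ 1 * row ℬ = row ℬ := by
  simp only [corner_mul_row, hℬ.one_mul]
  rfl

theorem column_mul_corner_one : column ℬ * corner ℬ 1 = column ℬ := by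
  simp only [column_mul_corner, hℬ.mul_one]
  rfl

theorem corner_mul_row_le_degree (t : G) : corner ℬ t * row ℬ ≤ degree ℬ t := by
  rw [corner_mul_row]
  refine iSup_le fun h => map_entry_le_degree ?_
  simpa using hℬ.mul_le t h

theorem column_mul_corner_le_degree (t : G) : column ℬ * corner ℬ t ≤ degree ℬ t := by
  rw [column_mul_corner]
  refine iSup_le fun g => map_entry_le_degree ?_
  simpa using hℬ.mul_le g⁻¹ t

theorem column_mul_corner_mul_row_le_degree (t : G) :
    column ℬ * (corner ℬ t * row ℬ) ≤ degree ℬ t := by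
  simp only [corner_mul_row, column, iSup_submodule_mul, submodule_mul_iSup,
    map_entry_mul_map_entry, iSup_le_iff]
  intro h g
  refine map_entry_le_degree ?_
  refine (submodule_mul_mono le_rfl (hℬ.mul_le t h)).trans ?_
  simpa [mul_assoc] using hℬ.mul_le g⁻¹ (t * h)

/-- In column `h` the left side has `ℬ t * ℬ t⁻¹ * ℬ h = ℬ t * ℬ (t⁻¹ * h)`, and the translation
moves it to column `t⁻¹ * h`, which is where the right side has it. Thus a translation can replace
multiplication by `ℬ t⁻¹`. -/
theorem map_shift_domain_mul_row (t : G) :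
    (corner ℬ t * corner ℬ t⁻¹ * row ℬ).map (shift 1 t⁻¹).toLinearMap = corner ℬ t * row ℬ := by
  rw [corner_mul_corner, map_entry_mul_row, corner_mul_row, Submodule.map_iSup]
  simp only [map_shift_map_entry, hℬ.domain_mul, mul_one]
  exact (Equiv.mulLeft t⁻¹).iSup_comp (g := fun h => (ℬ t * ℬ h).map (entry 1 h))

theorem map_shift_column_mul_domain (t : G) :
    (column ℬ * (corner ℬ t⁻¹ * corner ℬ t)).map (shift t 1).toLinearMap =
      column ℬ * corner ℬ t := by
  rw [corner_mul_corner, column_mul_map_entry, column_mul_corner, Submodule.map_iSup]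
  have e : ∀ g, ℬ g⁻¹ * (ℬ t⁻¹ * ℬ t) = ℬ (t * g)⁻¹ * ℬ t := fun g => by
    have := hℬ.mul_domain t⁻¹ g⁻¹
    rwa [inv_inv, ← mul_inv_rev] at this
  simp only [map_shift_map_entry, e, mul_one]
  exact (Equiv.mulLeft t).iSup_comp (g := fun g => (ℬ g⁻¹ * ℬ t).map (entry g 1))

/-- Conjugation by the translation `t` on the submodules of the full corner. -/
theorem map_shift_conj (t : G) (Z : Submodule k (FinMatrix k G B)) :
    (column ℬ * (corner ℬ t⁻¹ * corner ℬ t) * Z * (corner ℬ t⁻¹ * corner ℬ t * row ℬ)).map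
      (shift t t).toLinearMap = column ℬ * corner ℬ t * Z * (corner ℬ t⁻¹ * row ℬ) := by
  have e := map_shift_domain_mul_row hℬ t⁻¹
  rw [inv_inv] at e
  -- The translation is split over the three factors so that only the outer indices move: rows of
  -- the first factor, columns of the last, and nothing in `Z`.
  rw [map_shift_mul t 1 t, map_shift_mul t 1 1, map_shift_column_mul_domain hℬ, e,
    map_shift_one_one]

theorem map_shift_column_mul_domain_mul_row (t : G) :
    (column ℬ * (corner ℬ t * corner ℬ t⁻¹ * row ℬ)).map (shift 1 t⁻¹).toLinearMap =
      column ℬ * (corner ℬ t * row ℬ) := by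
  rw [map_shift_mul 1 1 t⁻¹, map_shift_domain_mul_row hℬ, map_shift_one_one]

end Corner

end FinMatrix

/-! ### The product partial action attached to a symmetric graded algebra -/

section Restriction

open FinMatrix

variable {k : Type*} {G : Type*} {B : Type*} [CommRing k] [Group G] [NonUnitalRing B] [Module k B]
  [IsScalarTower k B B] [SMulCommClass k B B] (ℬ : G → Submodule k B)

/-- The submodule `column * (corner g * corner g⁻¹ * row)`. -/
noncomputable def matrixDomain (g : G) : Submodule k (FinMatrix k G B) :=
  column ℬ * (corner ℬ g * corner ℬ g⁻¹ * row ℬ)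

variable {ℬ} (hℬ : IsSymmetric ℬ)
include hℬ

/-- The inner row and column multiply to `corner ℬ 1`, which the next corner absorbs. Products of
the ideals `matrixDomain` thereby reduce to products of the domains of `corner ℬ`. -/
theorem column_mul_row_mul_column_mul (Z W : Submodule k (FinMatrix k G B)) (t : G) :
    column ℬ * (Z * row ℬ) * (column ℬ * (corner ℬ t * W)) = column ℬ * (Z * (corner ℬ t * W)) := by
  have hb := corner_isSymmetric hℬ
  rw [mul_assoc, mul_assoc, ← mul_assoc (row ℬ), row_mul_column hℬ, ← mul_assoc (corner ℬ 1),
    hb.one_mul]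

theorem matrixDomain_one : matrixDomain ℬ 1 = column ℬ * row ℬ := by
  have hb := corner_isSymmetric hℬ
  rw [matrixDomain, inv_one, hb.one_mul, corner_one_mul_row hℬ]

theorem matrixDomain_mul (g h : G) : matrixDomain ℬ g * matrixDomain ℬ h =
    column ℬ * (corner ℬ g * corner ℬ g⁻¹ * (corner ℬ h * corner ℬ h⁻¹) * row ℬ) := by
  unfold matrixDomain
  rw [mul_assoc (corner ℬ h), column_mul_row_mul_column_mul hℬ]
  simp only [mul_assoc]

theorem matrixDomain_mul_self (g : G) :
    matrixDomain ℬ g * matrixDomain ℬ g = matrixDomain ℬ g := by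
  rw [matrixDomain_mul hℬ, (corner_isSymmetric hℬ).domain_idem, matrixDomain]

theorem matrixDomain_comm (g h : G) :
    matrixDomain ℬ g * matrixDomain ℬ h = matrixDomain ℬ h * matrixDomain ℬ g := by
  rw [matrixDomain_mul hℬ, matrixDomain_mul hℬ, (corner_isSymmetric hℬ).domain_comm]

theorem matrixDomain_one_mul (g : G) :
    matrixDomain ℬ 1 * matrixDomain ℬ g = matrixDomain ℬ g := by
  have hb := corner_isSymmetric hℬ
  rw [matrixDomain_mul hℬ, inv_one, hb.one_mul, ← mul_assoc (corner ℬ 1), hb.one_mul]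
  rfl

theorem matrixDomain_mul_one (g : G) :
    matrixDomain ℬ g * matrixDomain ℬ 1 = matrixDomain ℬ g := by
  rw [matrixDomain_comm hℬ, matrixDomain_one_mul hℬ]

theorem matrixDomain_le (g : G) : matrixDomain ℬ g ≤ column ℬ * row ℬ :=
   submodule_mul_mono le_rfl ((submodule_mul_mono
    ((corner_isSymmetric hℬ).mul_inv_le g) le_rfl).trans_eq (corner_one_mul_row hℬ))

/-- Write `b` for the corner, and apply `map_shift_conj` with the domain `b_h b_{h⁻¹}` in the
middle. Before translation it is flanked by two copies of the domain of `g⁻¹`, which merge because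
domains commute and are idempotent. After translation the middle is `b_g (b_h b_{h⁻¹}) b_{g⁻¹}`, and
moving the domain of `h` across `b_g` turns it into the domain of `g * h`. -/
theorem map_shift_matrixDomain_mul (g h : G) :
    (matrixDomain ℬ g⁻¹ * matrixDomain ℬ h).map (shift g g).toLinearMap =
      matrixDomain ℬ g * matrixDomain ℬ (g * h) := by
  have hb := corner_isSymmetric hℬ
  have e := map_shift_conj hℬ g (corner ℬ h * corner ℬ h⁻¹)
  have e1 : column ℬ * (corner ℬ g⁻¹ * corner ℬ g) * (corner ℬ h * corner ℬ h⁻¹) *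
      (corner ℬ g⁻¹ * corner ℬ g * row ℬ) = matrixDomain ℬ g⁻¹ * matrixDomain ℬ h := by
    have c := hb.domain_comm g⁻¹ h
    have i := hb.domain_idem g⁻¹
    rw [inv_inv] at c i
    rw [matrixDomain_mul hℬ, inv_inv, ← mul_assoc _ _ (row ℬ), mul_assoc (column ℬ), c,
      mul_assoc (column ℬ), mul_assoc (corner ℬ h * corner ℬ h⁻¹), i, ← c, mul_assoc]
  have e2 : column ℬ * corner ℬ g * (corner ℬ h * corner ℬ h⁻¹) * (corner ℬ g⁻¹ * row ℬ) =
      matrixDomain ℬ g * matrixDomain ℬ (g * h) := by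
    rw [matrixDomain_comm hℬ, matrixDomain_mul hℬ, ← mul_assoc (corner ℬ (g * h) * _),
      hb.domain_mul_eq_mul_domain]
    simp only [mul_assoc]
  rw [← e1, e, e2]

/-- This is the preceding identity for `h = g⁻¹`, where the second factor on the right is the whole
algebra. -/
theorem map_shift_matrixDomain (g : G) :
    (matrixDomain ℬ g⁻¹).map (shift g g).toLinearMap = matrixDomain ℬ g := by
  have := map_shift_matrixDomain_mul hℬ g g⁻¹
  rwa [matrixDomain_mul_self hℬ, mul_inv_cancel, matrixDomain_mul_one hℬ] at this

theorem shift_mem_matrixDomain {g : G} {x : FinMatrix k G B} (hx : x ∈ matrixDomain ℬ g⁻¹) :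
    shift g g x ∈ matrixDomain ℬ g := by
  rw [← map_shift_matrixDomain hℬ]
  exact Submodule.mem_map_of_mem hx

/-- The algebra spanned by the products of a column and a row. -/
noncomputable def fullCorner : NonUnitalSubalgebra k (FinMatrix k G B) :=
  { column ℬ * row ℬ with
    mul_mem' := by
      intro x y hx hy
      have := mul_mem_submodule_mul (P := column ℬ * row ℬ) (Q := column ℬ * row ℬ) hx hy
      rwa [← matrixDomain_one hℬ, matrixDomain_mul_self hℬ, matrixDomain_one hℬ] at this }

theorem mem_fullCorner {x : FinMatrix k G B} : x ∈ fullCorner hℬ ↔ x ∈ matrixDomain ℬ 1 := by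
  rw [matrixDomain_one hℬ]
  rfl

/-- The inclusion of the full corner into the matrix algebra. -/
noncomputable def fullCornerSubtype : fullCorner hℬ →ₗ[k] FinMatrix k G B :=
  (fullCorner hℬ).toSubmodule.subtype

theorem fullCornerSubtype_injective : Function.Injective (fullCornerSubtype hℬ) :=
  Subtype.val_injective

/-- The ideal `matrixDomain ℬ g` of the full corner. -/
noncomputable def domainAlgIdeal (g : G) : AlgIdeal k (fullCorner hℬ) :=
  { (matrixDomain ℬ g).comap (fullCornerSubtype hℬ) with
    mul_mem_left' := by
      intro a x hx
      have := mul_mem_submodule_mul ((mem_fullCorner hℬ).1 a.2)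
        (show (x : FinMatrix k G B) ∈ matrixDomain ℬ g from hx)
      rwa [matrixDomain_one_mul hℬ] at this
    mul_mem_right' := by
      intro a x hx
      have := mul_mem_submodule_mul (show (x : FinMatrix k G B) ∈ matrixDomain ℬ g from hx)
        ((mem_fullCorner hℬ).1 a.2)
      rwa [matrixDomain_mul_one hℬ] at this }

theorem mem_domainAlgIdeal {g : G} {x : fullCorner hℬ} :
    x ∈ domainAlgIdeal hℬ g ↔ (x : FinMatrix k G B) ∈ matrixDomain ℬ g := Iff.rfl

theorem map_domainAlgIdeal (g : G) :
    (domainAlgIdeal hℬ g).toSubmodule.map (fullCornerSubtype hℬ) = matrixDomain ℬ g := by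
  change ((matrixDomain ℬ g).comap (fullCorner hℬ).toSubmodule.subtype).map
    (fullCorner hℬ).toSubmodule.subtype = _
  rw [Submodule.map_comap_subtype, inf_eq_right]
  exact matrixDomain_le hℬ g

theorem map_domainAlgIdeal_mul (g h : G) :
    (domainAlgIdeal hℬ g * domainAlgIdeal hℬ h).toSubmodule.map (fullCornerSubtype hℬ) =
      matrixDomain ℬ g * matrixDomain ℬ h := by
  rw [AlgIdeal.mul_toSubmodule, mulSpan_eq_mul, map_submodule_mul (fun _ _ => rfl),
    map_domainAlgIdeal, map_domainAlgIdeal]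

/-- Products of these ideals may be computed in the ambient matrix algebra, so the identities for
`matrixDomain` yield the axioms of a partial action. -/
theorem mem_domainAlgIdeal_mul {g h : G} {x : fullCorner hℬ} :
    x ∈ domainAlgIdeal hℬ g * domainAlgIdeal hℬ h ↔
      (x : FinMatrix k G B) ∈ matrixDomain ℬ g * matrixDomain ℬ h := by
  rw [← map_domainAlgIdeal_mul hℬ]
  exact ((fullCornerSubtype_injective hℬ).mem_set_image (s := SetLike.coe
    (domainAlgIdeal hℬ g * domainAlgIdeal hℬ h).toSubmodule)).symm

/-- Simultaneous translation of rows and columns as a map between the ideals. -/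
noncomputable def domainShift (g h : G) (e : h = g⁻¹) :
    domainAlgIdeal hℬ h →ₗ[k] domainAlgIdeal hℬ g where
  toFun x :=
    have hx : shift g g (x : FinMatrix k G B) ∈ matrixDomain ℬ g :=
      shift_mem_matrixDomain hℬ (e ▸ (mem_domainAlgIdeal hℬ).1 x.2)
    ⟨⟨shift g g (x : FinMatrix k G B), matrixDomain_le hℬ g hx⟩, hx⟩
  map_add' _ _ := Subtype.ext (Subtype.ext (map_add (shift g g) _ _))
  map_smul' _ _ := Subtype.ext (Subtype.ext (map_smul (shift g g) _ _))

theorem coe_domainShift (g h : G) (e : h = g⁻¹) (x : domainAlgIdeal hℬ h) :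
    ((domainShift hℬ g h e x : fullCorner hℬ) : FinMatrix k G B) =
      shift g g (x : FinMatrix k G B) := rfl

/-- The isomorphism between the ideals given by simultaneous translation of rows and columns. -/
noncomputable def domainShiftEquiv (g : G) : domainAlgIdeal hℬ g⁻¹ ≃ₗ[k] domainAlgIdeal hℬ g :=
  -- The inverse is translation by `g⁻¹`. Its source has index `g` and not `(g⁻¹)⁻¹`, which is what
  -- the equality argument of `domainShift` accommodates.
  LinearEquiv.ofLinearMap (domainShift hℬ g g⁻¹ rfl) (domainShift hℬ g⁻¹ g (inv_inv g).symm)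
    (LinearMap.ext fun x => Subtype.ext (Subtype.ext (by
      simp only [LinearMap.comp_apply, coe_domainShift, shift_shift, mul_inv_cancel, shift_one_one]
      rfl)))
    (LinearMap.ext fun x => Subtype.ext (Subtype.ext (by
      simp only [LinearMap.comp_apply, coe_domainShift, shift_shift, inv_mul_cancel, shift_one_one]
      rfl)))

/-- The product partial action of `G` on the full corner by translations. -/
noncomputable def translationPartialAction : ProductPartialAction k G (fullCorner hℬ) where
  D := domainAlgIdeal hℬ
  α := domainShiftEquiv hℬ
  α_mul g x y := Subtype.ext (Subtype.ext (shift_mul_shift g g g _ _).symm)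
  D_one a := (mem_fullCorner hℬ).1 a.2
  α_one x := Subtype.ext (shift_one_one _)
  D_idem g := AlgIdeal.toSubmodule_injective <|
    Submodule.map_injective_of_injective (fullCornerSubtype_injective hℬ) <| by
      rw [map_domainAlgIdeal_mul, matrixDomain_mul_self hℬ, map_domainAlgIdeal]
  D_comm g h := AlgIdeal.toSubmodule_injective <|
    Submodule.map_injective_of_injective (fullCornerSubtype_injective hℬ) <| by
      rw [map_domainAlgIdeal_mul, map_domainAlgIdeal_mul, matrixDomain_comm hℬ]
  α_image g h := by
    ext y
    constructor
    · rintro ⟨x, hx, rfl⟩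
      refine (mem_domainAlgIdeal_mul hℬ).2 ?_
      rw [← map_shift_matrixDomain_mul hℬ]
      exact Submodule.mem_map_of_mem ((mem_domainAlgIdeal_mul hℬ).1 hx)
    · intro hy
      replace hy := (mem_domainAlgIdeal_mul hℬ).1 hy
      rw [← map_shift_matrixDomain_mul hℬ] at hy
      obtain ⟨x, hx, hxy⟩ := hy
      rw [SetLike.mem_coe, ← map_domainAlgIdeal_mul hℬ] at hx
      obtain ⟨x, hx, rfl⟩ := hx
      exact ⟨⟨x, PartialDatum.mem_left hx⟩, hx, Subtype.ext hxy⟩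
  comp g h x hx := Subtype.ext (shift_shift g g h h _)

/-- The skew group algebra of the translation partial action inside the matrix algebra:
`a δ_g` is sent to the translate of `a` whose column indices are shifted by `g⁻¹`. -/
noncomputable def skewGroupAlgebraToMatrix :
    (translationPartialAction hℬ).SkewGroupAlgebra →ₗ[k] FinMatrix k G B := by
  classical
  exact DirectSum.toModule k G (FinMatrix k G B) fun g => (shift 1 g⁻¹).toLinearMap ∘ₗ
    fullCornerSubtype hℬ ∘ₗ (domainAlgIdeal hℬ g).toSubmodule.subtype

theorem skewGroupAlgebraToMatrix_delta (g : G) (a : domainAlgIdeal hℬ g) :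
    skewGroupAlgebraToMatrix hℬ ((translationPartialAction hℬ).delta g a) =
      shift 1 g⁻¹ ((a : fullCorner hℬ) : FinMatrix k G B) := by
  classical
  exact DirectSum.toModule_lof k (M := fun g => domainAlgIdeal hℬ g) g a

/-- With formal permutation matrices, `a δ_g` is sent to `a λ_g` and `α g` is conjugation by `λ_g`,
so both sides are `a λ_g b λ_h`. -/
theorem skewGroupAlgebraToMatrix_mul (x y : (translationPartialAction hℬ).SkewGroupAlgebra) :
    skewGroupAlgebraToMatrix hℬ (x * y) =
      skewGroupAlgebraToMatrix hℬ x * skewGroupAlgebraToMatrix hℬ y := by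
  refine (translationPartialAction hℬ).toTwisted.map_mul_of_delta (fun g h a b => ?_) x y
  refine (congrArg _ ((translationPartialAction hℬ).delta_mul_delta g h a b)).trans ?_
  refine (skewGroupAlgebraToMatrix_delta hℬ (g * h) _).trans ?_
  refine Eq.trans ?_ (congrArg₂ (· * ·) (skewGroupAlgebraToMatrix_delta hℬ g a)
    (skewGroupAlgebraToMatrix_delta hℬ h b)).symm
  change shift 1 (g * h)⁻¹ (shift g g (shift g⁻¹ g⁻¹ ((a : fullCorner hℬ) : FinMatrix k G B) *
    ((b : fullCorner hℬ) : FinMatrix k G B))) =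
    shift 1 g⁻¹ ((a : fullCorner hℬ) : FinMatrix k G B) *
      shift 1 h⁻¹ ((b : fullCorner hℬ) : FinMatrix k G B)
  rw [← shift_mul_shift g g g, shift_shift, mul_inv_cancel, shift_one_one,
    ← shift_mul_shift 1 g⁻¹ (g * h)⁻¹, shift_shift, inv_mul_cancel, mul_inv_rev,
    inv_mul_cancel_right]

theorem map_skewGroupAlgebraToMatrix_grading (g : G) :
    ((translationPartialAction hℬ).grading g).map (skewGroupAlgebraToMatrix hℬ) =
      column ℬ * (corner ℬ g * row ℬ) := by
  rw [← map_shift_column_mul_domain_mul_row hℬ]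
  ext x
  constructor
  · rintro ⟨_, ⟨a, rfl⟩, rfl⟩
    exact ⟨_, a.2, (skewGroupAlgebraToMatrix_delta hℬ g a).symm⟩
  · rintro ⟨a, ha, rfl⟩
    exact ⟨_, ⟨⟨⟨a, matrixDomain_le hℬ g ha⟩, ha⟩, rfl⟩, skewGroupAlgebraToMatrix_delta hℬ g _⟩

end Restriction

open FinMatrix in
theorem skewGroupAlgebraToMatrix_injective {k : Type*} {G : Type*} {B : Type*} [CommRing k]
    [Group G] [NonUnitalRing B] [Module k B] [IsScalarTower k B B] [SMulCommClass k B B]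
    {ℬ : G → Submodule k B} (hℬ : IsSymmetric ℬ) (indep : iSupIndep ℬ) :
    Function.Injective (skewGroupAlgebraToMatrix hℬ) := by
  refine TwistedPartialAction.injective_of_delta _ (fun g a ha => ?_) ?_
  · have e := (skewGroupAlgebraToMatrix_delta hℬ g a).symm.trans ha
    rw [LinearEquiv.map_eq_zero_iff] at e
    exact Subtype.ext (Subtype.ext e)
  · refine (iSupIndep_degree indep).mono fun g => ?_
    exact (map_skewGroupAlgebraToMatrix_grading hℬ g).trans_le
      (column_mul_corner_mul_row_le_degree hℬ g)

/-! ### Idempotency and the main theorem -/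

section Idempotent

variable {k : Type*} {G : Type*} {A : Type*} [CommRing k] [Group G] [NonUnitalRing A] [Module k A]
  [IsScalarTower k A A] [SMulCommClass k A A] {𝒜 : G → Submodule k A}

theorem IsSymmetric.mulSpan_top (h𝒜 : IsSymmetric 𝒜) (hds : IsDirectSum 𝒜) :
    mulSpan (⊤ : Submodule k A) ⊤ = ⊤ :=
  map₂_top_eq_top hds fun t => ⟨𝒜 1, 𝒜 t, h𝒜.one_mul t⟩

end Idempotent

end PartialCrossed

open PartialCrossed FinMatrix in
theorem mainTheorem12 {k : Type w} {G : Type v} {A : Type u} [CommRing k] [Group G]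
    [NonUnitalRing A] [Module k A] [IsScalarTower k A A] [SMulCommClass k A A]
    (T : PartialCrossed.TwistedPartialAction k G A) :
    ∃ (A' : Type (max u v)) (_ : NonUnitalRing A') (_ : Module k A')
      (_ : IsScalarTower k A' A') (_ : SMulCommClass k A' A')
      (P : PartialCrossed.ProductPartialAction k G A'),
      PartialCrossed.StronglyGradedEquivalent T.grading P.grading := by
  have hℬ := T.grading_isSymmetric
  have indep := T.grading_isDirectSum.1
  let P := translationPartialAction hℬ
  have hP := P.toTwisted.grading_isSymmetric
  refine ⟨fullCorner hℬ, inferInstance, inferInstance, inferInstance, inferInstance, P,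
    { graded_left := T.grading_isGradedAlgebra
      graded_right := P.toTwisted.grading_isGradedAlgebra
      idem_left := hℬ.mulSpan_top T.grading_isDirectSum
      idem_right := hP.mulSpan_top P.toTwisted.grading_isDirectSum
      idem_domain_left := hℬ.domain_idem
      idem_domain_right := hP.domain_idem
      exists_context := ?_ }⟩
  -- The ambient algebra consists of the matrices over the crossed product; the crossed product
  -- itself is placed at the position `(1, 1)`.
  exact stronglyGradedEquivalent_of_corner (iA := entry 1 1) (iB := skewGroupAlgebraToMatrix hℬ)
    (entry_injective 1 1) (skewGroupAlgebraToMatrix_injective hℬ indep)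
    (fun a b => (entry_mul_entry_same 1 1 1 a b).symm) (skewGroupAlgebraToMatrix_mul hℬ)
    (corner_isSymmetric hℬ) (row_mul_column hℬ) (corner_one_mul_row hℬ) (column_mul_corner_one hℬ)
    T.grading_isGradedAlgebra P.toTwisted.grading_isGradedAlgebra (fun _ => rfl)
    (map_skewGroupAlgebraToMatrix_grading hℬ)
    ((iSupIndep_degree indep).mono (corner_mul_row_le_degree hℬ))
    ((iSupIndep_degree indep).mono (column_mul_corner_le_degree hℬ))
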